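/- Work in the polar-coordinate model of the hyperbolic plane $\mathbb{H}^2$ with pole $O$: a point $P$ has radius $r(P)$ and angle $\varphi(P)$, the pole lies on every ray from $O$, and $$|AB| = \operatorname{arcosh}\bigl(\cosh r(A)\cosh r(B) - \sinh r(A)\sinh r(B)\cos(\varphi(A)-\varphi(B))\bigr).$$ Let $\mathcal{S}\subset\mathbb{H}^2$ be a finite set of sites. A point $V$ is a Voronoi vertex if at least three sites are closest to $V$; these are the sites incident to $V$. The circle around $V$ through them is its witness circle, and its far point $V'$ is a point of this circle with the largest radius. For a sweep radius $\hat r$ let $\mathcal{S}_{\le \hat r}=\{S\in\mathcal{S} : r(S)\le \hat r\}$. The beach ellipse of $S\in\mathcal{S}_{\le \hat r}$ is $E_{\hat r}(S)=\{P : |PS| = \hat r - r(P)\}$. Its active part $A_{\hat r}(S)$ consists of those $P\in E_{\hat r}(S)$ for which there are no $S'\in\mathcal{S}_{\le \hat r}$ and $P'\in E_{\hat r}(S')$ on the same ray from $O$ as $P$ with $r(P)<r(P')$. The beach curve is $\mathcal{B}_{\hat r}=\bigcup_{S\in\mathcal{S}_{\le \hat r}} A_{\hat r}(S)$, and an active segment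 of $S$ at $\hat r$ is a connected component of $A_{\hat r}(S)$. A moving active segment of $S$ on an interval $J$ of radii is a family $(C_{\hat r})_{\hat r\in J}$, continuous with respect to the Hausdorff distance, of active segments of $S$. Let $J$ be non-empty with supremum $r<\infty$ (where $r\in J$ or $r\notin J$, and $J=\{r\}$ is allowed). The moving segment becomes inactive at $r$ if there are no $a\in J$, $\varepsilon>0$ and continuous $\gamma\colon[a,r+\varepsilon]\to\mathbb{H}^2$ with $\gamma(\hat r)\in C_{\hat r}$ for all $\hat r\in J$ with $\hat r\ge a$ and $\gamma(\hat r)\in A_{\hat r}(S)$ for all $\hat r\in[r,r+\varepsilon]$. (1) An active beach-ellipse segment can become inactive only through a circle event: if a moving active segment $(C_{\hat r})_{\hat r\in J}$ of $S$ becomes inactive at $r$, then there is a Voronoi vertex $V$, incident to $S$, with far point $V'$ such that $r=r(V')$ and the segment shrinks to $V$, i.e. $\sup_{P\in C_{\hat r}}|PV|\to 0$ as $\hat r\to r$ in $J$ (if $r \in J$, this includes $C_r=\{V\}$). (2) Let $r_i<r_j$ be consecutive elements of $\{0,\infty\}\cup\{r(S) : S\in\mathcal{S}\}\cup\{r(V')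 : V \text{ a Voronoi vertex}\}$ and let $r\in(r_i,r_j)$. Then no beach-ellipse intersection leaves the beach curve at $r$: for distinct $S,T\in\mathcal{S}_{\le r}$ there are no $\varepsilon>0$ and continuous $I\colon[r,r+\varepsilon]\to\mathbb{H}^2$ with $I(\hat r)\in E_{\hat r}(S)\cap E_{\hat r}(T)$ for all $\hat r\in[r,r+\varepsilon]$, $I(r)\in\mathcal{B}_r$, and $I(\hat r)\notin\mathcal{B}_{\hat r}$ for all $\hat r\in(r,r+\varepsilon]$. -/

import Mathlib

open Set Filter Topology

namespace HyperbolicSweep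

noncomputable section

/-- The hyperbolic plane in the polar-coordinate model: a complex number `z` stands for the point
whose polar coordinates (radius and angle around the pole) are `‖z‖` and `Complex.arg z`.
The topology of `ℂ` is the topology of the hyperbolic plane in these coordinates; the hyperbolic
metric is `hdist` below, and the Euclidean metric of `ℂ` is not used. -/
abbrev HPlane : Type := ℂ

/-- The radial coordinate: the hyperbolic distance to the pole. -/
def radius (P : HPlane) : ℝ := ‖P‖

/-- The angular coordinate, up to multiples of `2π`. -/
def angle (P : HPlane) : ℝ := Complex.arg P

/-- The hyperbolic distance of two points. -/
def hdist (A B : HPlane) : ℝ :=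
  Real.arcosh (Real.cosh (radius A) * Real.cosh (radius B) -
    Real.sinh (radius A) * Real.sinh (radius B) * Real.cos (angle A - angle B))

/-- Two points lie on a common ray from the pole. The pole has no angle of its own and
lies on every ray. -/
def SameAngle (P Q : HPlane) : Prop := P = 0 ∨ Q = 0 ∨ angle P = angle Q

/-! ### Voronoi vertices -/

/-- `S` is a site, and no site is closer to `V` than `S`. -/
def IsClosestSite (𝒮 : Finset HPlane) (V S : HPlane) : Prop :=
  S ∈ 𝒮 ∧ ∀ T ∈ 𝒮, hdist V S ≤ hdist V T

/-- `V` has (at least) three closest sites, i.e. it is the center of a circle with no site in its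
interior and at least three sites on its arc. -/
def IsVoronoiVertex (𝒮 : Finset HPlane) (V : HPlane) : Prop :=
  ∃ S₁ S₂ S₃ : HPlane, S₁ ≠ S₂ ∧ S₁ ≠ S₃ ∧ S₂ ≠ S₃ ∧
    IsClosestSite 𝒮 V S₁ ∧ IsClosestSite 𝒮 V S₂ ∧ IsClosestSite 𝒮 V S₃

/-- The circle around `V` through the sites closest to `V`. -/
def witnessCircle (𝒮 : Finset HPlane) (V : HPlane) : Set HPlane :=
  {Q | ∃ S, IsClosestSite 𝒮 V S ∧ hdist V Q = hdist V S}

/-- `V'` is a point of the witness circle of `V` with the largest radial coordinate. -/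
def IsFarPoint (𝒮 : Finset HPlane) (V V' : HPlane) : Prop :=
  V' ∈ witnessCircle 𝒮 V ∧ ∀ Q ∈ witnessCircle 𝒮 V, radius Q ≤ radius V'

/-! ### Beach ellipses and the beach curve -/

/-- The sites contained in the sweep circle of radius `R`. -/
def seenSites (𝒮 : Finset HPlane) (R : ℝ) : Set HPlane := {S | S ∈ 𝒮 ∧ radius S ≤ R}

/-- The points at equal distance to `S` and to the sweep circle of radius `R`; a point `P` of
radius at most `R` has distance `R - radius P` to the sweep circle. -/
def beachEllipse (S : HPlane) (R : ℝ) : Set HPlane := {P | hdist P S = R - radius P}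

/-- The active part of the beach ellipse of `S` when the sweep circle has radius `R`. -/
def activePart (𝒮 : Finset HPlane) (S : HPlane) (R : ℝ) : Set HPlane :=
  {P | S ∈ seenSites 𝒮 R ∧ P ∈ beachEllipse S R ∧
    ¬ ∃ S' ∈ seenSites 𝒮 R, ∃ P' ∈ beachEllipse S' R, SameAngle P P' ∧ radius P < radius P'}

/-- The beach curve when the sweep circle has radius `R`. -/
def beachCurve (𝒮 : Finset HPlane) (R : ℝ) : Set HPlane :=
  ⋃ S ∈ seenSites 𝒮 R, activePart 𝒮 S R

/-- `C` is an active segment of (the beach ellipse of) `S` at sweep radius `R`: a connected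
component of the active part. -/
def IsActiveSegment (𝒮 : Finset HPlane) (S : HPlane) (R : ℝ) (C : Set HPlane) : Prop :=
  ∃ P ∈ activePart 𝒮 S R, C = connectedComponentIn (activePart 𝒮 S R) P

/-! ### Events -/

/-- The radii of the true circle events. -/
def circleEvents (𝒮 : Finset HPlane) : Set ℝ :=
  {r | ∃ V V', IsVoronoiVertex 𝒮 V ∧ IsFarPoint 𝒮 V V' ∧ radius V' = r}

/-- The radii of the site events. -/
def siteEvents (𝒮 : Finset HPlane) : Set ℝ := {r | ∃ S ∈ 𝒮, radius S = r}

/-- The site events and the true circle events, together with the two end marks `0` and `∞`. -/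
def events (𝒮 : Finset HPlane) : Set EReal :=
  {0, ⊤} ∪ (fun r : ℝ => (r : EReal)) '' (siteEvents 𝒮 ∪ circleEvents 𝒮)

/-- `a < b` are consecutive events. -/
def ConsecutiveEvents (𝒮 : Finset HPlane) (a b : EReal) : Prop :=
  a ∈ events 𝒮 ∧ b ∈ events 𝒮 ∧ a < b ∧ ∀ c ∈ events 𝒮, ¬ (a < c ∧ c < b)

/-! ### Leaving the beach curve -/

/-- `I` is an intersection of the beach ellipses of `S` and `T` that moves (continuously) with the
sweep radius; it is on the beach curve at radius `r` but not on it right after `r`. -/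
def LeavesBeachCurveAt (𝒮 : Finset HPlane) (S T : HPlane) (I : ℝ → HPlane) (r : ℝ) : Prop :=
  ∃ ε > 0, ContinuousOn I (Icc r (r + ε)) ∧
    (∀ R ∈ Icc r (r + ε), I R ∈ beachEllipse S R ∩ beachEllipse T R) ∧
    I r ∈ beachCurve 𝒮 r ∧ ∀ R ∈ Ioc r (r + ε), I R ∉ beachCurve 𝒮 R

/-- For `R ∈ J`, `C R` is an active segment of `S` that moves continuously with `R`, with respect
to the Hausdorff distance of sets. -/
def IsMovingSegment (𝒮 : Finset HPlane) (S : HPlane) (J : Set ℝ) (C : ℝ → Set HPlane) : Prop :=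
  (∀ R ∈ J, IsActiveSegment 𝒮 S R (C R)) ∧
  ∀ R₀ ∈ J, ∀ δ > 0, ∀ᶠ R in 𝓝[J] R₀,
    (∀ P ∈ C R, ∃ Q ∈ C R₀, hdist P Q < δ) ∧ (∀ Q ∈ C R₀, ∃ P ∈ C R, hdist P Q < δ)

/-- The moving segment `C` of `S`, given for the radii in `J` (which end at `r`), is still active
after `r`, possibly split by other segments: some point that moves continuously with the sweep
radius lies on the segment before `r`, and stays in the active part of `S` for a while after `r`. -/
def RemainsActiveBeyond (𝒮 : Finset HPlane) (S : HPlane) (J : Set ℝ) (C : ℝ → Set HPlane)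
    (r : ℝ) : Prop :=
  ∃ a ∈ J, ∃ ε > 0, ∃ γ : ℝ → HPlane, ContinuousOn γ (Icc a (r + ε)) ∧
    (∀ R ∈ J, a ≤ R → γ R ∈ C R) ∧ ∀ R ∈ Icc r (r + ε), γ R ∈ activePart 𝒮 S R

/-- An active segment `C` of `S`, followed over an interval `J` of radii that ends at `r`, becomes
inactive at `r`. Both `r ∈ J` (the segment is last active at `r`; in particular `J = {r}`, where no
history is prescribed) and `r ∉ J` (it is active only before `r`) are allowed. -/
def BecomesInactiveAt (𝒮 : Finset HPlane) (S : HPlane) (J : Set ℝ) (C : ℝ → Set HPlane)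
    (r : ℝ) : Prop :=
  J.Nonempty ∧ J.OrdConnected ∧ IsLUB J r ∧ IsMovingSegment 𝒮 S J C ∧
    ¬ RemainsActiveBeyond 𝒮 S J C r

end

end HyperbolicSweep

open HyperbolicSweep

/-! For a site `S` strictly inside the sweep circle, the active part is the portion of the beach
ellipse in the Voronoi cell of `S`, without the points on the ray of a site lying on the sweep
circle (`mem_activePart_iff`). Around an ellipse point in the cell, the witness circle touches the
sweep circle from inside, so its far point has the sweep radius (`exists_isFarPoint`).

Each ray meets the ellipse once, so directions parametrise it. Along it, the comparison of the
distances to `T` and `S` is the sign of `excess S T θ R`, a trigonometric polynomial of degree at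
most one in `θ`. Its zeros are simple when `T ≠ S` is strictly inside as well
(`excessDeriv_ne_zero`).

Let a segment end at radius `r` and accumulate at `V`. If the excesses vanishing at `V` all grow in
the same angular direction, a small turn that way reaches the interior of the cell
(`exists_direction`), and the ellipse point in that fixed direction carries the segment beyond `r`
(`remainsActiveBeyond_of_frequently`). So at least two other sites tie with `S`, and `V` is a
Voronoi vertex (`IsJunction`). Junctions are isolated on the ellipse and segments are connected, so
the whole segment tends to one junction. When the sweep circle just meets `S`, the segment survives
(`remainsActiveBeyond_radius`).

For the second claim, away from events only `S` and `T` are closest to the intersection, and by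
continuity this persists (`not_leavesBeachCurveAt`). -/

namespace HyperbolicSweep

/-! ### Hyperboloid coordinates and the metric. -/

/-- The first spatial coordinate of a point in the hyperboloid model. -/
noncomputable def px (P : HPlane) : ℝ := Real.sinh (radius P) * Real.cos (angle P)

/-- The second spatial coordinate of a point in the hyperboloid model. -/
noncomputable def py (P : HPlane) : ℝ := Real.sinh (radius P) * Real.sin (angle P)

/-- The hyperbolic cosine of the distance, as the Lorentz form of the hyperboloid model. -/
noncomputable def lorentz (A B : HPlane) : ℝ :=
  Real.cosh (radius A) * Real.cosh (radius B) - (px A * px B + py A * py B)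

theorem hdist_eq_arcosh_lorentz (A B : HPlane) : hdist A B = Real.arcosh (lorentz A B) := by
  unfold hdist lorentz px py
  rw [Real.cos_sub]
  ring_nf

theorem radius_nonneg (P : HPlane) : 0 ≤ radius P := norm_nonneg P

theorem continuous_radius : Continuous radius := continuous_norm

theorem px_sq_add_py_sq (P : HPlane) : px P ^ 2 + py P ^ 2 = Real.sinh (radius P) ^ 2 := by
  unfold px py
  linear_combination Real.sinh (radius P) ^ 2 * Real.sin_sq_add_cos_sq (angle P)

theorem abs_px_le (P : HPlane) : |px P| ≤ Real.sinh (radius P) := by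
  have h := Real.sinh_nonneg_iff.2 (radius_nonneg P)
  exact abs_le_of_sq_le_sq (by nlinarith [px_sq_add_py_sq P, sq_nonneg (py P)]) h

theorem abs_py_le (P : HPlane) : |py P| ≤ Real.sinh (radius P) := by
  have h := Real.sinh_nonneg_iff.2 (radius_nonneg P)
  exact abs_le_of_sq_le_sq (by nlinarith [px_sq_add_py_sq P, sq_nonneg (px P)]) h

theorem tendsto_sinh_radius_zero : Tendsto (fun P : HPlane => Real.sinh (radius P)) (𝓝 0) (𝓝 0) := by
  have h : Continuous fun P : HPlane => Real.sinh (radius P) :=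
    Real.continuous_sinh.comp continuous_radius
  simpa [radius] using h.tendsto 0

/-- The jump of the angle is harmless: at the pole the factor `sinh` of the radius vanishes, and
elsewhere the cosine of the angle is `re / ‖·‖`. -/
theorem continuous_px : Continuous px := by
  rw [continuous_iff_continuousAt]
  intro P
  by_cases hP : P = 0
  · subst hP
    have h0 : px 0 = 0 := by simp [px, radius]
    rw [ContinuousAt, h0]
    exact squeeze_zero_norm (fun P => by simpa using abs_px_le P) tendsto_sinh_radius_zero
  · have hc : ContinuousAt (fun P : HPlane => Real.sinh ‖P‖ * (P.re / ‖P‖)) P := by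
      have : ‖P‖ ≠ 0 := norm_ne_zero_iff.2 hP
      fun_prop (disch := assumption)
    refine hc.congr ?_
    filter_upwards [isOpen_ne.mem_nhds hP] with Q hQ
    simp only [px, radius, angle, Complex.cos_arg hQ]

theorem continuous_py : Continuous py := by
  rw [continuous_iff_continuousAt]
  intro P
  by_cases hP : P = 0
  · subst hP
    have h0 : py 0 = 0 := by simp [py, radius]
    rw [ContinuousAt, h0]
    exact squeeze_zero_norm (fun P => by simpa using abs_py_le P) tendsto_sinh_radius_zero
  · have hc : ContinuousAt (fun P : HPlane => Real.sinh ‖P‖ * (P.im / ‖P‖)) P := by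
      have : ‖P‖ ≠ 0 := norm_ne_zero_iff.2 hP
      fun_prop (disch := assumption)
    refine hc.congr ?_
    filter_upwards [isOpen_ne.mem_nhds hP] with Q hQ
    simp only [py, radius, angle, Complex.sin_arg]

theorem lorentz_eq_cosh_sub_add (A B : HPlane) :
    lorentz A B = Real.cosh (radius A - radius B) +
      Real.sinh (radius A) * Real.sinh (radius B) * (1 - Real.cos (angle A - angle B)) := by
  unfold lorentz px py
  rw [Real.cosh_sub, Real.cos_sub]
  ring

theorem cosh_sub_le_lorentz (A B : HPlane) :
    Real.cosh (radius A - radius B) ≤ lorentz A B := by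
  rw [lorentz_eq_cosh_sub_add]
  have h1 := Real.sinh_nonneg_iff.2 (radius_nonneg A)
  have h2 := Real.sinh_nonneg_iff.2 (radius_nonneg B)
  have h3 := Real.cos_le_one (angle A - angle B)
  have := mul_nonneg (mul_nonneg h1 h2) (sub_nonneg.2 h3)
  linarith

theorem one_le_lorentz (A B : HPlane) : 1 ≤ lorentz A B :=
  (Real.one_le_cosh _).trans (cosh_sub_le_lorentz A B)

theorem cosh_hdist (A B : HPlane) : Real.cosh (hdist A B) = lorentz A B := by
  rw [hdist_eq_arcosh_lorentz, Real.cosh_arcosh (one_le_lorentz A B)]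

theorem hdist_nonneg (A B : HPlane) : 0 ≤ hdist A B := by
  rw [hdist_eq_arcosh_lorentz]
  exact Real.arcosh_nonneg (one_le_lorentz A B)

theorem hdist_le_hdist_iff (A B C D : HPlane) :
    hdist A B ≤ hdist C D ↔ lorentz A B ≤ lorentz C D := by
  rw [hdist_eq_arcosh_lorentz, hdist_eq_arcosh_lorentz,
    Real.arcosh_le_arcosh (by linarith [one_le_lorentz A B]) (by linarith [one_le_lorentz C D])]

theorem hdist_eq_iff {A B : HPlane} {d : ℝ} (hd : 0 ≤ d) :
    hdist A B = d ↔ lorentz A B = Real.cosh d := by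
  constructor
  · rintro rfl
    exact (cosh_hdist A B).symm
  · intro h
    rw [hdist_eq_arcosh_lorentz, h, Real.arcosh_cosh hd]

theorem continuous_hdist_left (T : HPlane) : Continuous fun P : HPlane => hdist P T := by
  simp_rw [hdist_eq_arcosh_lorentz]
  refine Real.continuousOn_arcosh.comp_continuous ?_ fun P => one_le_lorentz P T
  have h1 := continuous_px
  have h2 := continuous_py
  have h3 := continuous_radius
  have h4 := Real.continuous_cosh
  unfold lorentz
  fun_prop

/-- The triangle inequality through the pole, the only one for `hdist` that is needed. -/
theorem abs_radius_sub_le_hdist (A B : HPlane) : |radius A - radius B| ≤ hdist A B := by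
  have h := cosh_sub_le_lorentz A B
  rw [← cosh_hdist, Real.cosh_le_cosh, abs_of_nonneg (hdist_nonneg A B)] at h
  exact h

theorem half_sq_le_cosh_sub_one (x : ℝ) : x ^ 2 / 2 ≤ Real.cosh x - 1 := by
  have h : Real.cosh x = 1 + 2 * Real.sinh (x / 2) ^ 2 := by
    have := Real.cosh_two_mul (x / 2)
    rw [mul_div_cancel₀ x two_ne_zero, Real.cosh_sq] at this
    linarith
  have h2 : (x / 2) ^ 2 ≤ Real.sinh (x / 2) ^ 2 := by
    rw [← sq_abs (x / 2), ← sq_abs (Real.sinh (x / 2)), Real.abs_sinh]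
    gcongr
    exact Real.self_le_sinh_iff.2 (abs_nonneg _)
  nlinarith

/-- Term by term comparison of the Euclidean and the hyperbolic law of cosines, using `x ≤ sinh x`.
It transfers Hausdorff closeness in `hdist` to the topology of `ℂ`, uniformly in both points. -/
theorem sq_norm_sub_le (P Q : HPlane) : ‖P - Q‖ ^ 2 / 2 ≤ Real.cosh (hdist P Q) - 1 := by
  have key : ‖P - Q‖ ^ 2 =
      (‖P‖ - ‖Q‖) ^ 2 + 2 * (‖P‖ * ‖Q‖ * (1 - Real.cos (P.arg - Q.arg))) := by
    have h1 : ‖P - Q‖ ^ 2 = (P.re - Q.re) ^ 2 + (P.im - Q.im) ^ 2 := by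
      rw [← Complex.normSq_eq_norm_sq, Complex.normSq_apply]
      simp [sq]
    have h2 : ‖P‖ ^ 2 = P.re ^ 2 + P.im ^ 2 := by
      rw [← Complex.normSq_eq_norm_sq, Complex.normSq_apply]; ring
    have h3 : ‖Q‖ ^ 2 = Q.re ^ 2 + Q.im ^ 2 := by
      rw [← Complex.normSq_eq_norm_sq, Complex.normSq_apply]; ring
    rw [h1, Real.cos_sub]
    have a1 := Complex.norm_mul_cos_arg P
    have a2 := Complex.norm_mul_sin_arg P
    have a3 := Complex.norm_mul_cos_arg Q
    have a4 := Complex.norm_mul_sin_arg Q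
    linear_combination -h2 - h3 + 2 * (‖Q‖ * Real.cos Q.arg) * a1 + 2 * P.re * a3
      + 2 * (‖Q‖ * Real.sin Q.arg) * a2 + 2 * P.im * a4
  rw [key, cosh_hdist, lorentz_eq_cosh_sub_add]
  have h1 := half_sq_le_cosh_sub_one (radius P - radius Q)
  have h2 : ‖P‖ * ‖Q‖ ≤ Real.sinh (radius P) * Real.sinh (radius Q) :=
    mul_le_mul (Real.self_le_sinh_iff.2 (norm_nonneg P)) (Real.self_le_sinh_iff.2 (norm_nonneg Q))
      (norm_nonneg Q) (Real.sinh_nonneg_iff.2 (norm_nonneg P))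
  have h3 := mul_le_mul_of_nonneg_right h2 (sub_nonneg.2 (Real.cos_le_one (P.arg - Q.arg)))
  simp only [radius, angle] at *
  linarith

theorem exists_hdist_lt_imp_dist_lt {δ : ℝ} (hδ : 0 < δ) :
    ∃ η > 0, ∀ P Q : HPlane, hdist P Q < η → dist P Q < δ := by
  have h : 1 < 1 + δ ^ 2 / 2 := by have := pow_pos hδ 2; linarith
  refine ⟨Real.arcosh (1 + δ ^ 2 / 2), Real.arcosh_pos h, fun P Q hPQ => ?_⟩
  have h1 : Real.cosh (hdist P Q) < 1 + δ ^ 2 / 2 := by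
    rw [← Real.cosh_arcosh h.le, Real.cosh_lt_cosh, abs_of_nonneg (hdist_nonneg P Q),
      abs_of_nonneg (Real.arcosh_nonneg h.le)]
    exact hPQ
  have h2 := sq_norm_sub_le P Q
  rw [dist_eq_norm]
  exact lt_of_pow_lt_pow_left₀ 2 hδ.le (by linarith)

theorem hdist_eq_zero_iff (P Q : HPlane) : hdist P Q = 0 ↔ P = Q := by
  constructor
  · intro h
    have h1 := sq_norm_sub_le P Q
    rw [h, Real.cosh_zero] at h1
    have h2 : ‖P - Q‖ = 0 := by nlinarith [norm_nonneg (P - Q), sq_nonneg ‖P - Q‖]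
    exact sub_eq_zero.1 (norm_eq_zero.1 h2)
  · rintro rfl
    rw [hdist_eq_iff le_rfl, lorentz_eq_cosh_sub_add]
    simp

theorem hdist_self (P : HPlane) : hdist P P = 0 := (hdist_eq_zero_iff P P).2 rfl

theorem hdist_pos {P Q : HPlane} (h : P ≠ Q) : 0 < hdist P Q :=
  lt_of_le_of_ne (hdist_nonneg P Q) fun h' => h ((hdist_eq_zero_iff P Q).1 h'.symm)

theorem radius_eq_zero_iff (P : HPlane) : radius P = 0 ↔ P = 0 := norm_eq_zero

theorem hdist_zero_left (S : HPlane) : hdist 0 S = radius S := by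
  rw [hdist_eq_iff (radius_nonneg S), lorentz_eq_cosh_sub_add]
  simp [radius]

/-! ### Points in polar coordinates -/

/-- The point with polar coordinates `x` and `θ`. -/
noncomputable def polar (x θ : ℝ) : HPlane := x * Complex.exp (θ * Complex.I)

theorem continuous_polar : Continuous fun p : ℝ × ℝ => polar p.1 p.2 := by
  unfold polar
  fun_prop

theorem radius_polar {x : ℝ} (hx : 0 ≤ x) (θ : ℝ) : radius (polar x θ) = x := by
  simp [radius, polar, Complex.norm_exp_ofReal_mul_I, abs_of_nonneg hx]

theorem polar_radius_angle (P : HPlane) : polar (radius P) (angle P) = P :=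
  Complex.norm_mul_exp_arg_mul_I P

/-- The component of the hyperboloid coordinates of `S` in the direction `θ`. -/
noncomputable def dirComp (S : HPlane) (θ : ℝ) : ℝ := px S * Real.cos θ + py S * Real.sin θ

theorem px_polar {x : ℝ} (hx : 0 ≤ x) (θ : ℝ) : px (polar x θ) = Real.sinh x * Real.cos θ := by
  rcases hx.eq_or_lt with rfl | hx'
  · simp [px, radius, polar]
  · have h := Complex.norm_mul_cos_arg (polar x θ)
    have hr := radius_polar hx θ
    unfold px angle
    unfold radius at *
    rw [hr] at h ⊢
    have h2 : (polar x θ).re = x * Real.cos θ := by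
      simp [polar, Complex.exp_ofReal_mul_I_re]
    rw [h2] at h
    rw [mul_left_cancel₀ hx'.ne' h]

theorem py_polar {x : ℝ} (hx : 0 ≤ x) (θ : ℝ) : py (polar x θ) = Real.sinh x * Real.sin θ := by
  rcases hx.eq_or_lt with rfl | hx'
  · simp [py, radius, polar]
  · have h := Complex.norm_mul_sin_arg (polar x θ)
    have hr := radius_polar hx θ
    unfold py angle
    unfold radius at *
    rw [hr] at h ⊢
    have h2 : (polar x θ).im = x * Real.sin θ := by
      simp [polar, Complex.exp_ofReal_mul_I_im]
    rw [h2] at h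
    rw [mul_left_cancel₀ hx'.ne' h]

theorem lorentz_polar {x : ℝ} (hx : 0 ≤ x) (θ : ℝ) (S : HPlane) :
    lorentz (polar x θ) S =
      Real.cosh x * Real.cosh (radius S) - Real.sinh x * dirComp S θ := by
  rw [lorentz, px_polar hx, py_polar hx, radius_polar hx, dirComp]
  ring

theorem dirComp_eq (S : HPlane) (θ : ℝ) :
    dirComp S θ = Real.sinh (radius S) * Real.cos (θ - angle S) := by
  rw [dirComp, px, py, Real.cos_sub]
  ring

theorem abs_dirComp_le (S : HPlane) (θ : ℝ) : |dirComp S θ| ≤ Real.sinh (radius S) := by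
  have h := Real.sinh_nonneg_iff.2 (radius_nonneg S)
  rw [dirComp_eq, abs_mul, abs_of_nonneg h]
  exact mul_le_of_le_one_right h (Real.abs_cos_le_one _)

theorem hdist_polar_of_sameAngle {x : ℝ} (hx : 0 ≤ x) (S : HPlane) :
    hdist (polar x (angle S)) S = |x - radius S| := by
  rw [hdist_eq_iff (abs_nonneg _), lorentz_polar hx, dirComp_eq, Real.cosh_abs, Real.cosh_sub]
  simp

theorem angle_eq_of_hdist_eq {A B : HPlane} (hA : A ≠ 0) (hB : B ≠ 0)
    (h : hdist A B = |radius A - radius B|) : angle A = angle B := by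
  rw [hdist_eq_iff (abs_nonneg _), Real.cosh_abs, lorentz_eq_cosh_sub_add] at h
  have h1 := Real.sinh_pos_iff.2 (norm_pos_iff.2 hA)
  have h2 := Real.sinh_pos_iff.2 (norm_pos_iff.2 hB)
  have h3 : 1 - Real.cos (angle A - angle B) = 0 := by
    have h4 : Real.sinh (radius A) * Real.sinh (radius B) *
      (1 - Real.cos (angle A - angle B)) = 0 := by linarith
    exact (mul_eq_zero.1 h4).resolve_left (mul_pos h1 h2).ne'
  -- Both arguments lie in `(-π, π]`, so their difference lies strictly between `-2π` and `2π`.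
  have h5 : angle A - angle B = 0 := by
    refine (Real.cos_eq_one_iff_of_lt_of_lt ?_ ?_).1 (by linarith)
    · unfold angle; linarith [Complex.neg_pi_lt_arg A, Complex.arg_le_pi B]
    · unfold angle; linarith [Complex.neg_pi_lt_arg B, Complex.arg_le_pi A]
  linarith

/-! ### Beach ellipses and Voronoi cells. -/

theorem radius_le_of_mem_beachEllipse {S P : HPlane} {R : ℝ} (h : P ∈ beachEllipse S R) :
    radius P ≤ R := by
  have h1 : hdist P S = R - radius P := h
  linarith [hdist_nonneg P S]

theorem ne_zero_of_mem_beachEllipse {S P : HPlane} {R : ℝ} (hR : radius S < R)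
    (h : P ∈ beachEllipse S R) : P ≠ 0 := by
  rintro rfl
  have h1 : hdist 0 S = R - radius 0 := h
  rw [hdist_zero_left, (radius_eq_zero_iff 0).2 rfl] at h1
  linarith

theorem radius_lt_of_mem_beachEllipse {S P : HPlane} {R : ℝ} (hR : radius S < R)
    (h : P ∈ beachEllipse S R) : radius P < R := by
  refine lt_of_le_of_ne (radius_le_of_mem_beachEllipse h) fun h2 => ?_
  have h1 : hdist P S = R - radius P := h
  rw [h2, sub_self, hdist_eq_zero_iff] at h1
  rw [h1] at h2
  linarith

/-- Behind a point that is closer to `T` than to the sweep circle there is a point of the beach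
ellipse of `T` on the same ray. -/
theorem exists_mem_beachEllipse_of_hdist_lt {P T : HPlane} {R : ℝ} (hP : P ≠ 0)
    (h : hdist P T < R - radius P) :
    ∃ P' ∈ beachEllipse T R, SameAngle P P' ∧ radius P < radius P' := by
  have hP0 : 0 < radius P := norm_pos_iff.2 hP
  have hlt : radius P < R := by linarith [hdist_nonneg P T]
  -- Moving outwards on the ray of `P`, this sum starts below `R` and is at least `R` at radius `R`.
  have hc : Continuous fun x : ℝ => x + hdist (polar x (angle P)) T :=
    continuous_id.add ((continuous_hdist_left T).comp
      (continuous_polar.comp (continuous_id.prodMk continuous_const)))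
  obtain ⟨x, hx, hxR⟩ := intermediate_value_Icc hlt.le hc.continuousOn
    (show R ∈ Icc _ _ from ⟨by
      simp only [polar_radius_angle]; linarith, by
      linarith [hdist_nonneg (polar R (angle P)) T]⟩)
  have hxpos : 0 < x := hP0.trans_le hx.1
  have hrad := radius_polar hxpos.le (angle P)
  refine ⟨polar x (angle P), ?_, Or.inr (Or.inr ?_), ?_⟩
  · change hdist _ _ = _
    rw [hrad]
    simp only at hxR
    linarith
  · conv_lhs => rw [← polar_radius_angle P]
    unfold angle polar
    rw [Complex.arg_real_mul _ hP0, Complex.arg_real_mul _ hxpos]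
  · rw [hrad]
    refine lt_of_le_of_ne hx.1 ?_
    rintro rfl
    simp only [polar_radius_angle] at hxR
    linarith

/-- No point of the beach ellipse of `T` lies behind a point that is at least as close to the sweep
circle as to `T`. -/
theorem radius_le_of_sub_le_hdist {P P' T : HPlane} {R : ℝ} (hT : radius T < R) (hP : P ≠ 0)
    (hPR : radius P ≤ R) (h : R - radius P ≤ hdist P T) (h' : P' ∈ beachEllipse T R)
    (hang : SameAngle P P') : radius P' ≤ radius P := by
  by_contra! hlt
  have hP0 : 0 < radius P := norm_pos_iff.2 hP
  have hang' : angle P = angle P' := by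
    rcases hang with h0 | h0 | h0
    · exact absurd h0 hP
    · rw [h0, (radius_eq_zero_iff 0).2 rfl] at hlt
      linarith
    · exact h0
  have e1 : Real.cosh (R - radius P) ≤ lorentz P T := by
    rw [← cosh_hdist, Real.cosh_le_cosh, abs_of_nonneg (by linarith),
      abs_of_nonneg (hdist_nonneg P T)]
    exact h
  have e2 : lorentz P' T = Real.cosh (R - radius P') :=
    (hdist_eq_iff (by linarith [radius_le_of_mem_beachEllipse h'])).1 h'
  rw [← polar_radius_angle P, lorentz_polar hP0.le, radius_polar hP0.le, Real.cosh_sub] at e1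
  rw [← polar_radius_angle P', lorentz_polar (radius_nonneg P'), radius_polar (radius_nonneg P'),
    Real.cosh_sub, ← hang'] at e2
  have hk : 0 < Real.cosh R - Real.cosh (radius T) := by
    rw [sub_pos, Real.cosh_lt_cosh, abs_of_nonneg (radius_nonneg T),
      abs_of_nonneg (by linarith [radius_nonneg T])]
    exact hT
  have hs : Real.sinh (radius P' - radius P) > 0 := Real.sinh_pos_iff.2 (by linarith)
  rw [Real.sinh_sub] at hs
  have hc := Real.sinh_pos_iff.2 hP0
  have hc' := Real.sinh_pos_iff.2 (hP0.trans hlt)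
  -- Eliminating `dirComp T` between `e1` and `e2` leaves `(cosh R - cosh (radius T)) * sinh (radius
  -- P' - radius P) ≤ 0`.
  have := mul_le_mul_of_nonneg_left e1 hc'.le
  have := congrArg (fun z => Real.sinh (radius P) * z) e2
  nlinarith [mul_pos hk hs]

/-- Points of the active part of `S` are those points of its beach ellipse that belong to the
Voronoi cell of `S`, except the points on the ray of a site that is met by the sweep circle. -/
theorem mem_activePart_iff {𝒮 : Finset HPlane} {S P : HPlane} {R : ℝ} (hR : radius S < R) :
    P ∈ activePart 𝒮 S R ↔ S ∈ 𝒮 ∧ P ∈ beachEllipse S R ∧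
      ∀ T ∈ 𝒮, hdist P S ≤ hdist P T ∧ (radius T = R → hdist P S < hdist P T) := by
  constructor
  · rintro ⟨hS, hP, hno⟩
    refine ⟨hS.1, hP, fun T hT => ?_⟩
    have hPS : hdist P S = R - radius P := hP
    have hP0 := ne_zero_of_mem_beachEllipse hR hP
    have hlow := abs_radius_sub_le_hdist P T
    have hPlt := radius_lt_of_mem_beachEllipse hR hP
    have hle : hdist P S ≤ hdist P T := by
      by_contra! hlt
      rcases le_or_gt (radius T) R with hTR | hTR
      · obtain ⟨P', h1, h2, h3⟩ := exists_mem_beachEllipse_of_hdist_lt hP0 (hPS ▸ hlt)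
        exact hno ⟨T, ⟨hT, hTR⟩, P', h1, h2, h3⟩
      · linarith [neg_abs_le (radius P - radius T)]
    -- For `radius T = R` the ellipse of `T` degenerates to the radial segment from the pole to `T`.
    -- A tie puts `P` on that ray, where `T` itself lies farther out.
    refine ⟨hle, fun hTR => lt_of_le_of_ne hle fun heq => ?_⟩
    refine hno ⟨T, ⟨hT, hTR.le⟩, T, ?_, Or.inr (Or.inr ?_), hTR ▸ hPlt⟩
    · change hdist T T = R - radius T
      rw [hdist_self, hTR, sub_self]
    · refine angle_eq_of_hdist_eq hP0 ?_ ?_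
      · rintro rfl
        rw [(radius_eq_zero_iff 0).2 rfl] at hTR
        linarith [radius_nonneg S]
      · rw [← heq, hPS, hTR, abs_of_nonpos (by linarith)]
        ring
  · rintro ⟨hS, hP, hall⟩
    refine ⟨⟨hS, hR.le⟩, hP, ?_⟩
    rintro ⟨T, ⟨hT, hTR⟩, P', h1, h2, h3⟩
    have hPS : hdist P S = R - radius P := hP
    have hP0 := ne_zero_of_mem_beachEllipse hR hP
    rcases hTR.lt_or_eq with hlt | heq
    · have := radius_le_of_sub_le_hdist hlt hP0 (radius_le_of_mem_beachEllipse hP)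
        (hPS ▸ (hall T hT).1) h1 h2
      linarith
    · have hlt := (hall T hT).2 heq
      have h1' : hdist P' T = R - radius P' := h1
      have hang : angle P = angle P' := by
        rcases h2 with h0 | h0 | h0
        · exact absurd h0 hP0
        · rw [h0, (radius_eq_zero_iff 0).2 rfl] at h3
          linarith [radius_nonneg P]
        · exact h0
      have hP'0 : P' ≠ 0 := by
        rintro rfl
        rw [(radius_eq_zero_iff 0).2 rfl] at h3
        linarith [radius_nonneg P]
      have hT0 : T ≠ 0 := by
        rintro rfl
        rw [(radius_eq_zero_iff 0).2 rfl] at heq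
        linarith [radius_nonneg S]
      have hangT : angle P' = angle T := by
        refine angle_eq_of_hdist_eq hP'0 hT0 ?_
        rw [h1', heq, abs_of_nonpos (by linarith [radius_le_of_mem_beachEllipse h1])]
        ring
      have : hdist P T = |radius P - radius T| := by
        conv_lhs => rw [← polar_radius_angle P, hang, hangT]
        exact hdist_polar_of_sameAngle (radius_nonneg P) T
      rw [heq, abs_of_nonpos (by linarith [radius_le_of_mem_beachEllipse hP])] at this
      linarith

/-- If a point of the beach ellipse of `S` belongs to the Voronoi cell of `S`, its witness circle
touches the sweep circle. -/
theorem exists_isFarPoint {𝒮 : Finset HPlane} {S V : HPlane} {r : ℝ}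
    (hV : V ∈ beachEllipse S r) (hS : IsClosestSite 𝒮 V S) :
    ∃ V', IsFarPoint 𝒮 V V' ∧ radius V' = r := by
  have hVS : hdist V S = r - radius V := hV
  have hVr := radius_le_of_mem_beachEllipse hV
  have hr : 0 ≤ r := (radius_nonneg V).trans hVr
  -- The far point is `V` pushed outwards along its ray to the sweep circle.
  refine ⟨polar r (angle V), ⟨⟨S, hS, ?_⟩, ?_⟩, radius_polar hr _⟩
  · rw [hVS, hdist_eq_iff (by linarith)]
    have h1 := lorentz_polar hr (angle V) V
    rw [dirComp_eq, sub_self, Real.cos_zero, mul_one, ← Real.cosh_sub] at h1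
    rw [← h1]
    unfold lorentz
    ring
  · rintro Q ⟨S', hS', hQ⟩
    rw [radius_polar hr]
    have h1 := hS'.2 S hS.1
    have h2 := neg_abs_le (radius V - radius Q)
    linarith [abs_radius_sub_le_hdist V Q]

/-! ### Intersections between events. -/

theorem not_leavesBeachCurveAt {𝒮 : Finset HPlane} {S T : HPlane} {r : ℝ}
    (hsite : r ∉ siteEvents 𝒮) (hcircle : r ∉ circleEvents 𝒮) (hS : S ∈ seenSites 𝒮 r)
    (hT : T ∈ seenSites 𝒮 r) (hST : S ≠ T) (I : ℝ → HPlane) :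
    ¬ LeavesBeachCurveAt 𝒮 S T I r := by
  rintro ⟨ε, hε, hI, hmem, hr, hout⟩
  have hlt : ∀ U ∈ seenSites 𝒮 r, radius U < r := fun U hU =>
    lt_of_le_of_ne hU.2 fun h => hsite ⟨U, hU.1, h⟩
  have h0 : r ∈ Icc r (r + ε) := ⟨le_rfl, by linarith⟩
  have hVS : hdist (I r) S = r - radius (I r) := (hmem r h0).1
  have hVT : hdist (I r) T = r - radius (I r) := (hmem r h0).2
  -- The active site `S'` may differ from `S` and `T`, but all three are at distance `r - radius (I
  -- r)` from `I r`.
  obtain ⟨S', hS', hA⟩ := mem_iUnion₂.1 hr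
  rw [mem_activePart_iff (hlt S' hS')] at hA
  obtain ⟨-, hE', hcl⟩ := hA
  have hE'' : hdist (I r) S' = r - radius (I r) := hE'
  have hS_cl : IsClosestSite 𝒮 (I r) S := ⟨hS.1, fun U hU => by linarith [(hcl U hU).1]⟩
  have hT_cl : IsClosestSite 𝒮 (I r) T := ⟨hT.1, fun U hU => by linarith [(hcl U hU).1]⟩
  have hthird : ∀ U ∈ 𝒮, U ≠ S → U ≠ T → hdist (I r) S < hdist (I r) U := by
    intro U hU hUS hUT
    refine lt_of_le_of_ne (hS_cl.2 U hU) fun heq => hcircle ?_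
    obtain ⟨V', hV', hrad⟩ := exists_isFarPoint (hmem r h0).1 hS_cl
    exact ⟨I r, V', ⟨S, T, U, hST, hUS.symm, hUT.symm, hS_cl, hT_cl, hU,
      fun W hW => heq ▸ hS_cl.2 W hW⟩, hV', hrad⟩
  have hev : ∀ᶠ R in 𝓝[Icc r (r + ε)] r,
      ∀ U ∈ 𝒮, U ≠ S → U ≠ T → hdist (I R) S < hdist (I R) U := by
    rw [Finset.eventually_all]
    intro U hU
    by_cases hUS : U = S
    · exact Eventually.of_forall fun _ h => absurd hUS h
    by_cases hUT : U = T
    · exact Eventually.of_forall fun _ _ h => absurd hUT h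
    have c : ∀ W, Tendsto (fun R => hdist (I R) W) (𝓝[Icc r (r + ε)] r) (𝓝 (hdist (I r) W)) :=
      fun W => ((continuous_hdist_left W).tendsto _).comp (hI r h0)
    filter_upwards [(c S).eventually_lt (c U) (hthird U hU hUS hUT)] with R hR _ _ using hR
  have hsub : 𝓝[>] r ≤ 𝓝[Icc r (r + ε)] r := by
    rw [← nhdsWithin_Ioc_eq_nhdsGT (show r < r + ε by linarith)]
    exact nhdsWithin_mono _ Ioc_subset_Icc_self
  obtain ⟨R, hR, hRI⟩ := ((hev.filter_mono hsub).and
    (Ioc_mem_nhdsGT (show r < r + ε by linarith))).exists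
  have hRI' := Ioc_subset_Icc_self hRI
  have hSR : radius S < R := (hlt S hS).trans hRI.1
  have hTR : radius T < R := (hlt T hT).trans hRI.1
  have e1 : hdist (I R) S = R - radius (I R) := (hmem R hRI').1
  have e2 : hdist (I R) T = R - radius (I R) := (hmem R hRI').2
  refine hout R hRI (mem_iUnion₂.2 ⟨S, ⟨hS.1, hSR.le⟩, (mem_activePart_iff hSR).2
    ⟨hS.1, (hmem R hRI').1, fun U hU => ?_⟩⟩)
  by_cases hUS : U = S
  · subst hUS
    exact ⟨le_rfl, fun h => absurd h hSR.ne⟩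
  by_cases hUT : U = T
  · subst hUT
    exact ⟨by linarith, fun h => absurd h hTR.ne⟩
  · exact ⟨(hR U hU hUS hUT).le, fun _ => hR U hU hUS hUT⟩

theorem not_mem_events_between {𝒮 : Finset HPlane} {a b : EReal} (h : ConsecutiveEvents 𝒮 a b)
    {r : ℝ} (ha : a < (r : EReal)) (hb : (r : EReal) < b) :
    r ∉ siteEvents 𝒮 ∧ r ∉ circleEvents 𝒮 :=
  ⟨fun hr => h.2.2.2 r (Or.inr ⟨r, Or.inl hr, rfl⟩) ⟨ha, hb⟩,
    fun hr => h.2.2.2 r (Or.inr ⟨r, Or.inr hr, rfl⟩) ⟨ha, hb⟩⟩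

/-! ### The beach ellipse in polar coordinates. -/

theorem cosh_radius_lt_cosh {S : HPlane} {R : ℝ} (hR : radius S < R) :
    Real.cosh (radius S) < Real.cosh R := by
  rw [Real.cosh_lt_cosh, abs_of_nonneg (radius_nonneg S),
    abs_of_nonneg ((radius_nonneg S).trans hR.le)]
  exact hR

theorem continuous_dirComp (S : HPlane) : Continuous (dirComp S) := by
  unfold dirComp
  fun_prop

/-- The radius of the point of the beach ellipse of `S` in the direction `θ`. -/
noncomputable def ellipseRadius (S : HPlane) (θ R : ℝ) : ℝ :=
  Real.log ((Real.exp R - Real.cosh (radius S) - dirComp S θ) /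
    (Real.cosh (radius S) - dirComp S θ - Real.exp (-R))) / 2

/-- The point of the beach ellipse of `S` in the direction `θ`. -/
noncomputable def ellipsePoint (S : HPlane) (θ R : ℝ) : HPlane := polar (ellipseRadius S θ R) θ

/-- Since `|dirComp S θ| ≤ sinh (radius S)`, both `cosh (radius S) ± dirComp S θ` lie between `exp
(-radius S)` and `exp (radius S)`. This and the next bound keep the quotient in `ellipseRadius`
positive, away from the default values of division and logarithm. -/
theorem ellipse_num_pos {S : HPlane} {R : ℝ} (hR : radius S < R) (θ : ℝ) :
    0 < Real.exp R - Real.cosh (radius S) - dirComp S θ := by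
  have h1 := (abs_le.1 (abs_dirComp_le S θ)).2
  have h2 := Real.exp_lt_exp.2 hR
  rw [← Real.cosh_add_sinh (radius S)] at h2
  linarith

theorem ellipse_den_pos {S : HPlane} {R : ℝ} (hR : radius S < R) (θ : ℝ) :
    0 < Real.cosh (radius S) - dirComp S θ - Real.exp (-R) := by
  have h1 := (abs_le.1 (abs_dirComp_le S θ)).2
  have h2 := Real.exp_lt_exp.2 (neg_lt_neg hR)
  rw [← Real.cosh_sub_sinh (radius S)] at h2
  linarith

theorem exp_two_mul_ellipseRadius {S : HPlane} {R : ℝ} (hR : radius S < R) (θ : ℝ) :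
    Real.exp (2 * ellipseRadius S θ R) * (Real.cosh (radius S) - dirComp S θ - Real.exp (-R)) =
      Real.exp R - Real.cosh (radius S) - dirComp S θ := by
  have h1 := ellipse_num_pos hR θ
  have h2 := ellipse_den_pos hR θ
  rw [ellipseRadius, mul_div_cancel₀ _ two_ne_zero, Real.exp_log (div_pos h1 h2),
    div_mul_cancel₀ _ h2.ne']

theorem continuousAt_ellipseRadius {S : HPlane} {R : ℝ} (hR : radius S < R) (θ : ℝ) :
    ContinuousAt (fun p : ℝ × ℝ => ellipseRadius S p.1 p.2) (θ, R) := by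
  have h1 := ellipse_num_pos hR θ
  have h2 := ellipse_den_pos hR θ
  have h3 := continuous_dirComp S
  have h4 : ContinuousAt (fun p : ℝ × ℝ => (Real.exp p.2 - Real.cosh (radius S) - dirComp S p.1) /
      (Real.cosh (radius S) - dirComp S p.1 - Real.exp (-p.2))) (θ, R) := by
    refine ContinuousAt.div₀ ?_ ?_ h2.ne' <;> exact Continuous.continuousAt (by fun_prop)
  exact (h4.log (div_pos h1 h2).ne').div_const 2

theorem continuousAt_ellipsePoint {S : HPlane} {R : ℝ} (hR : radius S < R) (θ : ℝ) :
    ContinuousAt (fun p : ℝ × ℝ => ellipsePoint S p.1 p.2) (θ, R) := by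
  unfold ellipsePoint polar
  have h := continuousAt_ellipseRadius hR θ
  refine ContinuousAt.mul (Complex.continuous_ofReal.continuousAt.comp h) ?_
  exact Continuous.continuousAt (by fun_prop)

theorem ellipseRadius_pos {S : HPlane} {R : ℝ} (hR : radius S < R) (θ : ℝ) :
    0 < ellipseRadius S θ R := by
  have h1 := ellipse_den_pos hR θ
  have h2 := exp_two_mul_ellipseRadius hR θ
  have h3 := cosh_radius_lt_cosh hR
  rw [Real.cosh_eq R] at h3
  have h4 : 1 < Real.exp (2 * ellipseRadius S θ R) := by
    by_contra! h
    nlinarith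
  have := Real.one_lt_exp_iff.1 h4
  linarith

/-- Multiplication by `2 * exp x` makes the equation linear in `exp (2 * x)`. This yields the
formula for `ellipseRadius` and the uniqueness of the point on each ray. -/
theorem ellipse_equation_iff {S : HPlane} {θ R x : ℝ} :
    Real.cosh x * Real.cosh (radius S) - Real.sinh x * dirComp S θ = Real.cosh (R - x) ↔
      Real.exp (2 * x) * (Real.cosh (radius S) - dirComp S θ - Real.exp (-R)) =
        Real.exp R - Real.cosh (radius S) - dirComp S θ := by
  have e1 : Real.exp (2 * x) = Real.exp x * Real.exp x := by rw [← Real.exp_add]; ring_nf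
  have e2 : Real.exp x * Real.exp (-x) = 1 := by rw [← Real.exp_add]; simp
  have e3 := Real.exp_pos x
  have e5 : Real.exp (R - x) = Real.exp R * Real.exp (-x) := by rw [← Real.exp_add]; ring_nf
  have e6 : Real.exp (-(R - x)) = Real.exp (-R) * Real.exp x := by rw [← Real.exp_add]; ring_nf
  rw [Real.cosh_eq x, Real.sinh_eq x, Real.cosh_eq (R - x), e1, e5, e6]
  constructor
  · intro h
    linear_combination (2 * Real.exp x) * h +
      (Real.exp R - Real.cosh (radius S) - dirComp S θ) * e2
  · intro h
    refine mul_left_cancel₀ (mul_pos two_pos e3).ne' ?_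
    linear_combination h - (Real.exp R - Real.cosh (radius S) - dirComp S θ) * e2

/-- The equation in `cosh (R - x)` only sees `|R - x|`; this bound fixes the sign. -/
theorem ellipseRadius_le {S : HPlane} {R : ℝ} (hR : radius S < R) (θ : ℝ) :
    ellipseRadius S θ R ≤ R := by
  have h1 := ellipse_den_pos hR θ
  have h2 := exp_two_mul_ellipseRadius hR θ
  have hq := abs_le.1 (abs_dirComp_le S θ)
  have hc := Real.cosh_sq (radius S)
  have e0 := Real.exp_pos R
  have e1 : Real.exp R * Real.exp (-R) = 1 := by rw [← Real.exp_add]; simp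
  have e2 : Real.exp (2 * R) = Real.exp R ^ 2 := by rw [sq, ← Real.exp_add]; ring_nf
  set a := Real.cosh (radius S) - dirComp S θ with ha
  have ha0 : 0 < a := by linarith [Real.exp_pos (-R)]
  have hab : 1 ≤ a * (Real.cosh (radius S) + dirComp S θ) := by nlinarith
  have h3 : Real.exp (2 * ellipseRadius S θ R) ≤ Real.exp (2 * R) := by
    refine le_of_mul_le_mul_right ?_ h1
    rw [h2, e2]
    -- Arithmetic and geometric means, with `hab` bounding the product of the two coefficients below
    -- by `1`.
    have h4 : 2 * Real.exp R ≤ Real.exp R ^ 2 * a + (Real.cosh (radius S) + dirComp S θ) := by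
      refine le_of_mul_le_mul_left ?_ ha0
      nlinarith [sq_nonneg (Real.exp R * a - 1)]
    have h5 : Real.exp R ^ 2 * Real.exp (-R) = Real.exp R := by
      rw [sq, mul_assoc, e1, mul_one]
    nlinarith
  have := Real.exp_le_exp.1 h3
  linarith

theorem radius_ellipsePoint {S : HPlane} {R : ℝ} (hR : radius S < R) (θ : ℝ) :
    radius (ellipsePoint S θ R) = ellipseRadius S θ R :=
  radius_polar (ellipseRadius_pos hR θ).le θ

theorem ellipsePoint_mem_beachEllipse {S : HPlane} {R : ℝ} (hR : radius S < R) (θ : ℝ) :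
    ellipsePoint S θ R ∈ beachEllipse S R := by
  change hdist _ _ = _
  rw [radius_ellipsePoint hR, hdist_eq_iff (sub_nonneg.2 (ellipseRadius_le hR θ)),
    ellipsePoint, lorentz_polar (ellipseRadius_pos hR θ).le, ellipse_equation_iff]
  exact exp_two_mul_ellipseRadius hR θ

theorem eq_ellipsePoint {S : HPlane} {R x θ : ℝ} (hR : radius S < R) (hx : 0 ≤ x)
    (h : polar x θ ∈ beachEllipse S R) : polar x θ = ellipsePoint S θ R := by
  have h0 : hdist _ _ = _ := h
  have hle := radius_le_of_mem_beachEllipse h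
  rw [radius_polar hx] at h0 hle
  rw [hdist_eq_iff (sub_nonneg.2 hle), lorentz_polar hx, ellipse_equation_iff,
    ← exp_two_mul_ellipseRadius hR θ] at h0
  have h1 := Real.exp_injective (mul_right_cancel₀ (ellipse_den_pos hR θ).ne' h0)
  rw [ellipsePoint]
  congr 1
  linarith

/-! ### Comparing distances along a beach ellipse. -/

/-- On the beach ellipse of `S` this function of the direction has the sign of the difference of
the distances to `T` and to `S`. -/
noncomputable def excess (S T : HPlane) (θ R : ℝ) : ℝ :=
  (Real.cosh (radius T) - Real.cosh (radius S)) * Real.sinh R +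
    (Real.cosh R - Real.cosh (radius T)) * dirComp S θ -
    (Real.cosh R - Real.cosh (radius S)) * dirComp T θ

/-- The derivative of `excess` with respect to the direction. -/
noncomputable def excessDeriv (S T : HPlane) (θ R : ℝ) : ℝ :=
  (Real.cosh R - Real.cosh (radius T)) * (py S * Real.cos θ - px S * Real.sin θ) -
    (Real.cosh R - Real.cosh (radius S)) * (py T * Real.cos θ - px T * Real.sin θ)

theorem continuous_excess (S T : HPlane) : Continuous fun p : ℝ × ℝ => excess S T p.1 p.2 := by
  unfold excess dirComp
  fun_prop

theorem continuous_excessDeriv (S T : HPlane) :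
    Continuous fun p : ℝ × ℝ => excessDeriv S T p.1 p.2 := by
  unfold excessDeriv
  fun_prop

theorem hasDerivAt_dirComp (S : HPlane) (θ : ℝ) :
    HasDerivAt (dirComp S) (py S * Real.cos θ - px S * Real.sin θ) θ := by
  have h := ((Real.hasDerivAt_cos θ).const_mul (px S)).add
    ((Real.hasDerivAt_sin θ).const_mul (py S))
  refine h.congr_deriv ?_
  ring

theorem hasDerivAt_excess (S T : HPlane) (θ R : ℝ) :
    HasDerivAt (fun x => excess S T x R) (excessDeriv S T θ R) θ :=
  (((hasDerivAt_dirComp S θ).const_mul _).const_add _).sub ((hasDerivAt_dirComp T θ).const_mul _)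

/-- The ellipse equation reads `(cosh R - cosh (radius S)) * cosh x = (sinh R - dirComp S θ) * sinh
x`. Substituting it eliminates `cosh x`, and the remaining prefactors are positive. -/
theorem lorentz_sub_lorentz_ellipsePoint {S : HPlane} (T : HPlane) {R : ℝ} (hR : radius S < R)
    (θ : ℝ) :
    (Real.cosh R - Real.cosh (radius S)) *
      (lorentz (ellipsePoint S θ R) T - lorentz (ellipsePoint S θ R) S) =
      Real.sinh (ellipseRadius S θ R) * excess S T θ R := by
  have h := ellipse_equation_iff.2 (exp_two_mul_ellipseRadius hR θ)
  rw [Real.cosh_sub] at h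
  have hx := (ellipseRadius_pos hR θ).le
  rw [ellipsePoint, lorentz_polar hx, lorentz_polar hx, excess]
  linear_combination (Real.cosh (radius T) - Real.cosh (radius S)) * -h

theorem hdist_le_iff_excess_nonneg {S : HPlane} (T : HPlane) {R : ℝ} (hR : radius S < R) (θ : ℝ) :
    hdist (ellipsePoint S θ R) S ≤ hdist (ellipsePoint S θ R) T ↔ 0 ≤ excess S T θ R := by
  have h1 := sub_pos.2 (cosh_radius_lt_cosh hR)
  have h2 := Real.sinh_pos_iff.2 (ellipseRadius_pos hR θ)
  rw [hdist_le_hdist_iff, ← sub_nonneg, ← mul_nonneg_iff_of_pos_left h1,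
    lorentz_sub_lorentz_ellipsePoint T hR, mul_nonneg_iff_of_pos_left h2]

theorem hdist_lt_iff_excess_pos {S : HPlane} (T : HPlane) {R : ℝ} (hR : radius S < R) (θ : ℝ) :
    hdist (ellipsePoint S θ R) S < hdist (ellipsePoint S θ R) T ↔ 0 < excess S T θ R := by
  have h1 := sub_pos.2 (cosh_radius_lt_cosh hR)
  have h2 := Real.sinh_pos_iff.2 (ellipseRadius_pos hR θ)
  rw [← not_le, hdist_le_hdist_iff, not_le, ← sub_pos, ← mul_pos_iff_of_pos_left h1,
    lorentz_sub_lorentz_ellipsePoint T hR, mul_pos_iff_of_pos_left h2]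

/-- Beach ellipses of distinct sites intersect transversally. -/
theorem excessDeriv_ne_zero {S T : HPlane} {θ R : ℝ} (hS : radius S < R) (hT : radius T < R)
    (hST : S ≠ T) (h : excess S T θ R = 0) : excessDeriv S T θ R ≠ 0 := by
  intro h'
  have h1 := sub_pos.2 (cosh_radius_lt_cosh hS)
  have h2 := sub_pos.2 (cosh_radius_lt_cosh hT)
  have h3 : 1 < lorentz S T := by
    rw [← cosh_hdist, Real.one_lt_cosh]
    exact (hdist_pos hST).ne'
  have n1 := px_sq_add_py_sq S
  have n2 := px_sq_add_py_sq T
  have c1 := Real.cosh_sq (radius S)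
  have c2 := Real.cosh_sq (radius T)
  have c3 := Real.cosh_sq R
  have c4 := Real.sin_sq_add_cos_sq θ
  -- As a function of `θ`, the excess is `k - A cos θ - B sin θ`. A common zero with its derivative
  -- gives `k² = A² + B²`, which the hyperboloid equations reduce to this product.
  have key : 2 * (Real.cosh R - Real.cosh (radius S)) * (Real.cosh R - Real.cosh (radius T)) *
      (1 - lorentz S T) = 0 := by
    unfold lorentz
    unfold excess dirComp at h
    unfold excessDeriv at h'
    generalize Real.cosh (radius S) = cs at *
    generalize Real.cosh (radius T) = ct at *
    generalize Real.cosh R = cR at *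
    generalize Real.sinh R = sR at *
    generalize Real.sinh (radius S) = ss at *
    generalize Real.sinh (radius T) = st at *
    generalize px S = a at *
    generalize py S = b at *
    generalize px T = c at *
    generalize py T = d at *
    generalize Real.cos θ = x at *
    generalize Real.sin θ = y at *
    have hA : ((ct - cs) * sR) ^ 2 =
        (((cR - cs) * c - (cR - ct) * a) * x + ((cR - cs) * d - (cR - ct) * b) * y) ^ 2 := by
      congr 1
      linear_combination h
    have hB : (((cR - cs) * d - (cR - ct) * b) * x - ((cR - cs) * c - (cR - ct) * a) * y) ^ 2
        = 0 := by
      rw [sq_eq_zero_iff]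
      linear_combination -h'
    have hC : ((ct - cs) * sR) ^ 2 =
        ((cR - cs) * c - (cR - ct) * a) ^ 2 + ((cR - cs) * d - (cR - ct) * b) ^ 2 := by
      linear_combination hA - hB + (((cR - cs) * c - (cR - ct) * a) ^ 2 +
        ((cR - cs) * d - (cR - ct) * b) ^ 2) * c4
    have e1 : a ^ 2 + b ^ 2 = cs ^ 2 - 1 := by linarith
    have e2 : c ^ 2 + d ^ 2 = ct ^ 2 - 1 := by linarith
    linear_combination hC + (cR - ct) ^ 2 * e1 + (cR - cs) ^ 2 * e2 + (ct - cs) ^ 2 * c3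
  have : 0 < 2 * (Real.cosh R - Real.cosh (radius S)) * (Real.cosh R - Real.cosh (radius T)) *
      (lorentz S T - 1) := by
    have := sub_pos.2 h3
    positivity
  linarith

/-- An ellipse point `P` is at distance `R - radius P` from `S` but at least `radius T - radius P`
from `T`. -/
theorem excess_pos_of_radius_lt {S T : HPlane} {R : ℝ} (hS : radius S < R) (hT : R < radius T)
    (θ : ℝ) : 0 < excess S T θ R := by
  rw [← hdist_lt_iff_excess_pos T hS]
  have h : hdist _ _ = _ := ellipsePoint_mem_beachEllipse hS θ
  rw [h]
  linarith [abs_radius_sub_le_hdist (ellipsePoint S θ R) T,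
    neg_abs_le (radius (ellipsePoint S θ R) - radius T)]

/-- A site on the sweep circle gives a double zero in its own direction. Transversality fails there,
so such sites need separate treatment. -/
theorem excess_eq_of_radius_eq (S : HPlane) {T : HPlane} {R : ℝ} (hT : radius T = R) (θ : ℝ) :
    excess S T θ R = (Real.cosh R - Real.cosh (radius S)) * Real.sinh R *
      (1 - Real.cos (θ - angle T)) := by
  rw [excess, dirComp_eq T, hT]
  ring

theorem ellipsePoint_mem_activePart_iff {𝒮 : Finset HPlane} {S : HPlane} (hS : S ∈ 𝒮) {R : ℝ}
    (hR : radius S < R) (θ : ℝ) :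
    ellipsePoint S θ R ∈ activePart 𝒮 S R ↔
      ∀ T ∈ 𝒮, 0 ≤ excess S T θ R ∧ (radius T = R → 0 < excess S T θ R) := by
  simp only [mem_activePart_iff hR, hS, ellipsePoint_mem_beachEllipse hR, true_and,
    hdist_le_iff_excess_nonneg _ hR, hdist_lt_iff_excess_pos _ hR]

theorem excess_self (S : HPlane) (θ R : ℝ) : excess S S θ R = 0 := by
  unfold excess
  ring

/-! ### Local structure of the active part -/

theorem excess_lt_excess {S T : HPlane} {θ₀ η R σ : ℝ} (hσ : σ = 1 ∨ σ = -1)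
    (h : ∀ θ ∈ Ioo (θ₀ - η) (θ₀ + η), 0 < σ * excessDeriv S T θ R) {x y : ℝ}
    (hx : x ∈ Ioo (θ₀ - η) (θ₀ + η)) (hy : y ∈ Ioo (θ₀ - η) (θ₀ + η)) (hxy : 0 < σ * (y - x)) :
    excess S T x R < excess S T y R := by
  have hc : ContinuousOn (fun x => excess S T x R) (Ioo (θ₀ - η) (θ₀ + η)) :=
    fun x _ => (hasDerivAt_excess S T x R).continuousAt.continuousWithinAt
  rcases hσ with rfl | rfl
  · refine strictMonoOn_of_deriv_pos (convex_Ioo _ _) hc (fun x hx => ?_) hx hy (by linarith)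
    rw [interior_Ioo] at hx
    rw [(hasDerivAt_excess S T x R).deriv]
    linarith [h x hx]
  · refine strictAntiOn_of_deriv_neg (convex_Ioo _ _) hc (fun x hx => ?_) hy hx (by linarith)
    rw [interior_Ioo] at hx
    rw [(hasDerivAt_excess S T x R).deriv]
    linarith [h x hx]

/-- If the ellipses that meet the beach ellipse of `S` in the direction `θ₀` all cross it from the
same side, then nearby points of the active part can be joined inside the active part to a point in
a fixed direction `θ₁`. -/
theorem exists_direction {𝒯 : Finset HPlane} {S : HPlane} {θ₀ r σ : ℝ} (hσ : σ = 1 ∨ σ = -1)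
    (h : ∀ T ∈ 𝒯, 0 < excess S T θ₀ r ∨ 0 < σ * excessDeriv S T θ₀ r)
    (h0 : ∀ T ∈ 𝒯, 0 ≤ excess S T θ₀ r) {D : Set ℝ} (hD : D.Countable) :
    ∃ θ₁ ∉ D, (∀ T ∈ 𝒯, 0 < excess S T θ₁ r) ∧
      ∀ᶠ p : ℝ × ℝ in 𝓝 (θ₀, r), (∀ T ∈ 𝒯, 0 ≤ excess S T p.1 p.2) →
        ∀ θ ∈ uIcc p.1 θ₁, ∀ T ∈ 𝒯, 0 ≤ excess S T θ p.2 ∧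
          (0 < excess S T θ₀ r → 0 < excess S T θ p.2) := by
  -- On a box around `(θ₀, r)` the positive excesses stay positive and the others are strictly
  -- monotone in direction `σ`.
  have hbox : ∀ᶠ p : ℝ × ℝ in 𝓝 (θ₀, r), ∀ T ∈ 𝒯,
      (0 < excess S T θ₀ r → 0 < excess S T p.1 p.2) ∧
      (¬ 0 < excess S T θ₀ r → 0 < σ * excessDeriv S T p.1 p.2) := by
    rw [Finset.eventually_all]
    intro T hT
    by_cases hpos : 0 < excess S T θ₀ r
    · filter_upwards [(continuous_excess S T).continuousAt.eventually_const_lt hpos] with p hp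
      exact ⟨fun _ => hp, fun h => absurd hpos h⟩
    · have h1 := (h T hT).resolve_left hpos
      have hc : Continuous fun p : ℝ × ℝ => σ * excessDeriv S T p.1 p.2 :=
        continuous_const.mul (continuous_excessDeriv S T)
      filter_upwards [hc.continuousAt.eventually_const_lt h1] with p hp
      exact ⟨fun h => absurd h hpos, fun _ => hp⟩
  obtain ⟨η, hη, hball⟩ := Metric.eventually_nhds_iff_ball.1 hbox
  have hbx : ∀ θ R, |θ - θ₀| < η → |R - r| < η → (θ, R) ∈ Metric.ball (θ₀, r) η := by
    intro θ R h1 h2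
    rw [Metric.mem_ball, Prod.dist_eq, Real.dist_eq, Real.dist_eq]
    exact max_lt h1 h2
  have hsq : σ * σ = 1 := by rcases hσ with rfl | rfl <;> norm_num
  -- `θ₁` is chosen on the `σ`-side of `θ₀`, within the box and outside the countable set `D`.
  have hUo : IsOpen ((fun θ : ℝ => σ * (θ - θ₀)) ⁻¹' Ioo 0 η) :=
    isOpen_Ioo.preimage (by fun_prop)
  obtain ⟨θ₁, ⟨hm0, hmη⟩, hθD⟩ := (hD.dense_compl ℝ).inter_open_nonempty _ hUo
    ⟨θ₀ + σ * (η / 2), by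
      have : σ * (θ₀ + σ * (η / 2) - θ₀) = η / 2 := by linear_combination η / 2 * hsq
      rw [mem_preimage, this]
      constructor <;> linarith⟩
  have habs : ∀ x, σ * x ≤ |x| := by
    intro x
    rcases hσ with rfl | rfl
    · simpa using le_abs_self x
    · simpa using neg_le_abs x
  have habs' : |θ₁ - θ₀| = σ * (θ₁ - θ₀) := by
    rcases hσ with rfl | rfl
    · rw [abs_of_nonneg (by linarith)]; ring
    · rw [abs_of_nonpos (by linarith)]; ring
  have hIoo : ∀ θ, |θ - θ₀| < η ↔ θ ∈ Ioo (θ₀ - η) (θ₀ + η) := by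
    intro θ
    rw [abs_lt, mem_Ioo]
    constructor <;> rintro ⟨h1, h2⟩ <;> constructor <;> linarith
  have hmono : ∀ T ∈ 𝒯, ¬ 0 < excess S T θ₀ r → ∀ R, |R - r| < η → ∀ x y,
      |x - θ₀| < η → |y - θ₀| < η → 0 < σ * (y - x) → excess S T x R < excess S T y R := by
    intro T hT hn R hR x y hx hy hxy
    refine excess_lt_excess hσ (fun θ hθ => ?_) ((hIoo x).1 hx) ((hIoo y).1 hy) hxy
    exact (hball _ (hbx θ R ((hIoo θ).2 hθ) hR) T hT).2 hn
  have hr : |r - r| < η := by simpa using hη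
  refine ⟨θ₁, hθD, fun T hT => ?_, ?_⟩
  · by_cases hpos : 0 < excess S T θ₀ r
    · exact (hball _ (hbx θ₁ r (by linarith) hr) T hT).1 hpos
    · exact (h0 T hT).trans_lt
        (hmono T hT hpos r hr θ₀ θ₁ (by simpa using hη) (by linarith) hm0)
  · refine Metric.eventually_nhds_iff_ball.2 ⟨σ * (θ₁ - θ₀), hm0, fun p hp hnn θ hθ T hT => ?_⟩
    rw [Metric.mem_ball, Prod.dist_eq, Real.dist_eq, Real.dist_eq, max_lt_iff] at hp
    obtain ⟨hp1, hp2⟩ := hp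
    have hθ' : |θ - θ₀| ≤ σ * (θ₁ - θ₀) ∧ 0 ≤ σ * (θ - p.1) := by
      have h1 := (abs_lt.1 hp1).1
      have h2 := (abs_lt.1 hp1).2
      simp only at h1 h2
      rcases hσ with rfl | rfl
      · rw [uIcc_of_le (by linarith)] at hθ
        exact ⟨abs_le.2 ⟨by linarith [hθ.1], by linarith [hθ.2]⟩, by linarith [hθ.1]⟩
      · rw [uIcc_of_ge (by linarith)] at hθ
        exact ⟨abs_le.2 ⟨by linarith [hθ.1], by linarith [hθ.2]⟩, by linarith [hθ.2]⟩
    by_cases hpos : 0 < excess S T θ₀ r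
    · have := (hball _ (hbx θ p.2 (by linarith) (by linarith)) T hT).1 hpos
      exact ⟨this.le, fun _ => this⟩
    · refine ⟨?_, fun h => absurd h hpos⟩
      rcases hθ'.2.eq_or_lt with heq | hlt
      · have : θ = p.1 := by
          have : σ * (σ * (θ - p.1)) = 0 := by rw [← heq, mul_zero]
          rw [← mul_assoc, hsq] at this
          linarith
        rw [this]
        exact hnn T hT
      · exact (hnn T hT).trans (hmono T hT hpos p.2 (by linarith) p.1 θ (by linarith)
          (by linarith) hlt).le

/-- If neither sign works, there are vanishing excesses with derivative `≤ 0` and with derivative `≥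
0`. By transversality they belong to different sites. -/
theorem exists_two_crossings_or_side {𝒯 : Finset HPlane} {S : HPlane} {θ₀ r : ℝ}
    (hS : radius S < r) (h : ∀ T ∈ 𝒯, T ≠ S ∧ 0 ≤ excess S T θ₀ r ∧
      (radius T < r ∨ 0 < excess S T θ₀ r)) :
    (∃ T₁ ∈ 𝒯, ∃ T₂ ∈ 𝒯, T₁ ≠ T₂ ∧ excess S T₁ θ₀ r = 0 ∧ excess S T₂ θ₀ r = 0) ∨
      ∃ σ : ℝ, (σ = 1 ∨ σ = -1) ∧
        ∀ T ∈ 𝒯, 0 < excess S T θ₀ r ∨ 0 < σ * excessDeriv S T θ₀ r := by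
  by_contra! hcon
  obtain ⟨h1, h2⟩ := hcon
  obtain ⟨T₁, hT₁, e₁, d₁⟩ := h2 1 (Or.inl rfl)
  obtain ⟨T₂, hT₂, e₂, d₂⟩ := h2 (-1) (Or.inr rfl)
  have z₁ := le_antisymm e₁ (h T₁ hT₁).2.1
  have z₂ := le_antisymm e₂ (h T₂ hT₂).2.1
  refine h1 T₁ hT₁ T₂ hT₂ ?_ z₁ z₂
  rintro rfl
  refine excessDeriv_ne_zero hS ((h T₁ hT₁).2.2.resolve_right e₁.not_gt) (h T₁ hT₁).1.symm z₁ ?_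
  linarith

/-! ### Local angles and active segments. -/

/-- The angle of `P`, chosen close to the angle of `V` if `P` is close to `V`. -/
noncomputable def nearAngle (V P : HPlane) : ℝ := angle V + Complex.arg (P / V)

theorem polar_nearAngle {V : HPlane} (hV : V ≠ 0) (P : HPlane) :
    polar (radius P) (nearAngle V P) = P := by
  have h1 := Complex.norm_mul_exp_arg_mul_I (P / V)
  have h2 := Complex.norm_mul_exp_arg_mul_I V
  have h3 : ((‖P‖ : ℝ) : ℂ) = ((‖V‖ : ℝ) : ℂ) * ((‖P / V‖ : ℝ) : ℂ) := by
    rw [← Complex.ofReal_mul, norm_div, mul_div_cancel₀ _ (norm_ne_zero_iff.2 hV)]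
  unfold polar radius nearAngle angle
  rw [Complex.ofReal_add, add_mul, Complex.exp_add, h3]
  calc _ = ((‖V‖ : ℝ) : ℂ) * Complex.exp (V.arg * Complex.I) *
        (((‖P / V‖ : ℝ) : ℂ) * Complex.exp ((P / V).arg * Complex.I)) := by ring
    _ = P := by rw [h1, h2, mul_div_cancel₀ _ hV]

/-- Dividing by `V` moves the base point to `1`, away from the branch cut of `arg`. -/
theorem tendsto_nearAngle {V : HPlane} (hV : V ≠ 0) :
    Tendsto (nearAngle V) (𝓝 V) (𝓝 (angle V)) := by
  have h1 : ContinuousAt (fun P : HPlane => P / V) V := continuousAt_id.div_const V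
  have h2 : ContinuousAt Complex.arg (V / V) := by
    rw [div_self hV]
    exact Complex.continuousAt_arg (by simp)
  unfold nearAngle
  have h3 := (ContinuousAt.comp (f := fun P : HPlane => P / V) h2 h1).tendsto.const_add (angle V)
  simpa [div_self hV, Function.comp_def] using h3

theorem ellipsePoint_nearAngle {S V P : HPlane} {R : ℝ} (hR : radius S < R) (hV : V ≠ 0)
    (hP : P ∈ beachEllipse S R) : ellipsePoint S (nearAngle V P) R = P := by
  have h := polar_nearAngle hV P
  rw [← eq_ellipsePoint hR (radius_nonneg P) (h.symm ▸ hP), h]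

theorem ellipsePoint_angle {S V : HPlane} {R : ℝ} (hR : radius S < R)
    (hV : V ∈ beachEllipse S R) : ellipsePoint S (angle V) R = V := by
  have h := polar_radius_angle V
  rw [← eq_ellipsePoint hR (radius_nonneg V) (h.symm ▸ hV), h]

theorem IsActiveSegment.subset {𝒮 : Finset HPlane} {S : HPlane} {R : ℝ} {C : Set HPlane}
    (h : IsActiveSegment 𝒮 S R C) : C ⊆ activePart 𝒮 S R := by
  obtain ⟨P, -, rfl⟩ := h
  exact connectedComponentIn_subset _ _

theorem IsActiveSegment.isPreconnected {𝒮 : Finset HPlane} {S : HPlane} {R : ℝ} {C : Set HPlane}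
    (h : IsActiveSegment 𝒮 S R C) : IsPreconnected C := by
  obtain ⟨P, -, rfl⟩ := h
  exact isPreconnected_connectedComponentIn

theorem IsActiveSegment.nonempty {𝒮 : Finset HPlane} {S : HPlane} {R : ℝ} {C : Set HPlane}
    (h : IsActiveSegment 𝒮 S R C) : C.Nonempty := by
  obtain ⟨P, hP, rfl⟩ := h
  exact ⟨P, mem_connectedComponentIn hP⟩

theorem IsActiveSegment.subset_of_isPreconnected {𝒮 : Finset HPlane} {S : HPlane} {R : ℝ}
    {C X : Set HPlane} (h : IsActiveSegment 𝒮 S R C) (hX : IsPreconnected X)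
    (hXA : X ⊆ activePart 𝒮 S R) {P : HPlane} (hPC : P ∈ C) (hPX : P ∈ X) : X ⊆ C := by
  obtain ⟨Q, -, rfl⟩ := h
  rw [connectedComponentIn_eq hPC]
  exact hX.subset_connectedComponentIn hPX hXA

theorem continuousOn_ellipsePoint (S : HPlane) (θ : ℝ) :
    ContinuousOn (ellipsePoint S θ) (Ioi (radius S)) := fun R hR =>
  (ContinuousAt.comp (f := fun R : ℝ => (θ, R)) (continuousAt_ellipsePoint hR θ)
    (by fun_prop)).continuousWithinAt

theorem continuous_ellipsePoint {S : HPlane} {R : ℝ} (hR : radius S < R) :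
    Continuous fun θ => ellipsePoint S θ R :=
  continuous_iff_continuousAt.2 fun θ =>
    ContinuousAt.comp (f := fun θ : ℝ => (θ, R)) (continuousAt_ellipsePoint hR θ) (by fun_prop)

theorem IsActiveSegment.ellipsePoint_mem {𝒮 : Finset HPlane} {S : HPlane} {R θ θ₁ : ℝ}
    {C : Set HPlane} (h : IsActiveSegment 𝒮 S R C) (hR : radius S < R)
    (hθ : ellipsePoint S θ R ∈ C)
    (harc : ∀ θ' ∈ uIcc θ θ₁, ellipsePoint S θ' R ∈ activePart 𝒮 S R) :
    ellipsePoint S θ₁ R ∈ C :=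
  h.subset_of_isPreconnected
    (isPreconnected_uIcc.image _ (continuous_ellipsePoint hR).continuousOn)
    (image_subset_iff.2 harc) hθ (mem_image_of_mem _ left_mem_uIcc)
    (mem_image_of_mem _ right_mem_uIcc)

/-! ### Interior directions. -/

/-- The direction `θ` is in the interior of the active part of `S` at the sweep radius `r`. -/
def IsInteriorDirection (𝒮 : Finset HPlane) (S : HPlane) (r θ : ℝ) : Prop :=
  ∀ T ∈ 𝒮, T ≠ S → 0 < excess S T θ r

theorem ellipsePoint_mem_activePart {𝒮 : Finset HPlane} {S : HPlane} (hS : S ∈ 𝒮) {R θ : ℝ}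
    (hR : radius S < R) (h : IsInteriorDirection 𝒮 S R θ) :
    ellipsePoint S θ R ∈ activePart 𝒮 S R := by
  rw [ellipsePoint_mem_activePart_iff hS hR]
  intro T hT
  by_cases hTS : T = S
  · subst hTS
    exact ⟨(excess_self _ _ _).ge, fun h => absurd h hR.ne⟩
  · exact ⟨(h T hT hTS).le, fun _ => h T hT hTS⟩

theorem IsInteriorDirection.eventually {𝒮 : Finset HPlane} {S : HPlane} {r θ : ℝ}
    (h : IsInteriorDirection 𝒮 S r θ) :
    ∀ᶠ p : ℝ × ℝ in 𝓝 (θ, r), ∀ θ' ∈ uIcc p.1 θ, IsInteriorDirection 𝒮 S p.2 θ' := by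
  have h1 : ∀ᶠ p : ℝ × ℝ in 𝓝 (θ, r), IsInteriorDirection 𝒮 S p.2 p.1 := by
    unfold IsInteriorDirection
    rw [Finset.eventually_all]
    intro T hT
    by_cases hTS : T = S
    · exact Eventually.of_forall fun _ h => absurd hTS h
    filter_upwards [(continuous_excess S T).continuousAt.eventually_const_lt (h T hT hTS)]
      with p hp _ using hp
  obtain ⟨η, hη, hball⟩ := Metric.eventually_nhds_iff_ball.1 h1
  refine Metric.eventually_nhds_iff_ball.2 ⟨η, hη, fun p hp θ' hθ' => hball (θ', p.2) ?_⟩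
  rw [Metric.mem_ball, Prod.dist_eq, max_lt_iff] at hp ⊢
  refine ⟨lt_of_le_of_lt ?_ hp.1, hp.2⟩
  simp only [Real.dist_eq]
  rw [uIcc_comm] at hθ'
  exact abs_sub_left_of_mem_uIcc hθ'

/-- Active segments that come close to an interior point in the direction `θ` contain the point in
this direction. -/
theorem IsInteriorDirection.eventually_mem {𝒮 : Finset HPlane} {S : HPlane} (hS : S ∈ 𝒮)
    {r θ : ℝ} (hr : radius S < r) (h : IsInteriorDirection 𝒮 S r θ) :
    ∀ᶠ p : HPlane × ℝ in 𝓝 (ellipsePoint S θ r, r),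
      ∀ C, IsActiveSegment 𝒮 S p.2 C → p.1 ∈ C → ellipsePoint S θ p.2 ∈ C := by
  set Q := ellipsePoint S θ r with hQ
  have hQE : Q ∈ beachEllipse S r := ellipsePoint_mem_beachEllipse hr θ
  have hQ0 : Q ≠ 0 := ne_zero_of_mem_beachEllipse hr hQE
  -- `θ` may differ from `angle Q` by a multiple of `2π`, so the local angle is based at `θ` itself.
  have ht : Tendsto (fun p : HPlane × ℝ => (θ + Complex.arg (p.1 / Q), p.2)) (𝓝 (Q, r))
      (𝓝 (θ, r)) := by
    rw [nhds_prod_eq, nhds_prod_eq]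
    have h1 := (tendsto_nearAngle hQ0).const_add (θ - angle Q)
    rw [sub_add_cancel] at h1
    refine Tendsto.prodMap (f := fun P => θ + Complex.arg (P / Q)) (h1.congr fun P => ?_)
      tendsto_id
    unfold nearAngle
    ring
  have hlt : ∀ᶠ p : HPlane × ℝ in 𝓝 (Q, r), radius S < p.2 :=
    continuous_snd.continuousAt.eventually_const_lt hr
  filter_upwards [ht.eventually h.eventually, hlt] with p hp hpr C hC hpC
  have hpE : p.1 ∈ beachEllipse S p.2 := (hC.subset hpC).2.1
  have hpol : polar (radius p.1) (θ + Complex.arg (p.1 / Q)) = p.1 := by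
    have h1 : Complex.exp ((angle Q : ℝ) * Complex.I) = Complex.exp (θ * Complex.I) := by
      have h2 := polar_radius_angle Q
      have h3 : Q = polar (radius Q) θ := by
        conv_lhs => rw [hQ, ellipsePoint]
        rw [hQ, radius_ellipsePoint hr]
      conv_rhs at h2 => rw [h3]
      unfold polar at h2
      exact mul_left_cancel₀ (by simpa [radius] using hQ0) h2
    have h4 := polar_nearAngle hQ0 p.1
    unfold nearAngle at h4
    conv_rhs => rw [← h4]
    unfold polar
    rw [Complex.ofReal_add, Complex.ofReal_add, add_mul, add_mul, Complex.exp_add,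
      Complex.exp_add, h1]
  have hpt : ellipsePoint S (θ + Complex.arg (p.1 / Q)) p.2 = p.1 := by
    rw [← eq_ellipsePoint hpr (radius_nonneg p.1) (hpol.symm ▸ hpE), hpol]
  exact hC.ellipsePoint_mem hpr (hpt.symm ▸ hpC)
    fun θ' hθ' => ellipsePoint_mem_activePart hS hpr (hp θ' hθ')

/-! ### Junctions -/

/-- A point of the beach ellipse and the Voronoi cell of `S` where the beach ellipses of two more
sites meet. -/
def IsJunction (𝒮 : Finset HPlane) (S : HPlane) (r : ℝ) (V : HPlane) : Prop :=
  V ∈ beachEllipse S r ∧ IsClosestSite 𝒮 V S ∧ ∃ T₁ ∈ 𝒮, ∃ T₂ ∈ 𝒮, T₁ ≠ T₂ ∧ T₁ ≠ S ∧ T₂ ≠ S ∧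
    radius T₁ < r ∧ hdist V T₁ = hdist V S ∧ hdist V T₂ = hdist V S

theorem IsJunction.isVoronoiVertex {𝒮 : Finset HPlane} {S V : HPlane} {r : ℝ}
    (h : IsJunction 𝒮 S r V) : IsVoronoiVertex 𝒮 V := by
  obtain ⟨-, hS, T₁, h₁, T₂, h₂, h12, h1S, h2S, -, e₁, e₂⟩ := h
  exact ⟨S, T₁, T₂, h1S.symm, h2S.symm, h12, hS, ⟨h₁, fun T hT => e₁ ▸ hS.2 T hT⟩,
    ⟨h₂, fun T hT => e₂ ▸ hS.2 T hT⟩⟩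

theorem hdist_eq_iff_excess_eq_zero {S : HPlane} (T : HPlane) {R : ℝ} (hR : radius S < R) (θ : ℝ) :
    hdist (ellipsePoint S θ R) T = hdist (ellipsePoint S θ R) S ↔ excess S T θ R = 0 := by
  have h1 := hdist_le_iff_excess_nonneg T hR θ
  have h2 := hdist_lt_iff_excess_pos T hR θ
  constructor
  · intro h
    exact le_antisymm (not_lt.1 fun h' => (h2.2 h').ne' h) (h1.1 h.ge)
  · intro h
    exact le_antisymm (not_lt.1 fun h' => (h2.1 h').ne' h) (h1.2 h.ge)

theorem eventually_excess_ne_zero {S T : HPlane} {r θ : ℝ} (hS : radius S < r) (hT : radius T < r)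
    (hST : S ≠ T) : ∀ᶠ x in 𝓝[≠] θ, excess S T x r ≠ 0 := by
  by_cases h : excess S T θ r = 0
  · have := (hasDerivAt_excess S T θ r).eventually_ne (c := 0) (excessDeriv_ne_zero hS hT hST h)
    exact this
  · exact (hasDerivAt_excess S T θ r).continuousAt.continuousWithinAt.eventually_ne h

/-- A junction is a zero of the excess of a site of radius less than `r`, and such zeros are simple.
This is why `IsJunction` asks for `radius T₁ < r`. -/
theorem eventually_not_isJunction {𝒮 : Finset HPlane} {S V : HPlane} {r : ℝ} (hS : radius S < r)
    (hV : V ∈ beachEllipse S r) : ∀ᶠ P in 𝓝[≠] V, ¬ IsJunction 𝒮 S r P := by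
  have hV0 := ne_zero_of_mem_beachEllipse hS hV
  have h1 : ∀ᶠ x in 𝓝[≠] (angle V), ∀ T ∈ 𝒮, T ≠ S → radius T < r → excess S T x r ≠ 0 := by
    rw [Finset.eventually_all]
    intro T _
    by_cases hTS : T = S
    · exact Eventually.of_forall fun _ h => absurd hTS h
    by_cases hTr : radius T < r
    · filter_upwards [eventually_excess_ne_zero hS hTr (Ne.symm hTS)] with x hx _ _ using hx
    · exact Eventually.of_forall fun _ _ h => absurd h hTr
  rw [eventually_nhdsWithin_iff] at h1 ⊢
  filter_upwards [(tendsto_nearAngle hV0).eventually h1] with P hP hPV hJ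
  obtain ⟨hPE, -, T₁, hT₁, -, -, -, h1S, -, hTr, e₁, -⟩ := hJ
  have hpt := ellipsePoint_nearAngle hS hV0 hPE
  refine hP (fun heq => hPV ?_) T₁ hT₁ h1S hTr ?_
  · rw [mem_singleton_iff] at heq ⊢
    rw [← hpt, heq, ellipsePoint_angle hS hV]
  · rw [← hdist_eq_iff_excess_eq_zero T₁ hS, hpt]
    exact e₁

theorem isJunction_of_crossings {𝒮 : Finset HPlane} {S V : HPlane} {r : ℝ} (hS : radius S < r)
    (hV : V ∈ beachEllipse S r) (hcl : IsClosestSite 𝒮 V S) {T₁ T₂ : HPlane} (h₁ : T₁ ∈ 𝒮)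
    (h₂ : T₂ ∈ 𝒮) (h12 : T₁ ≠ T₂) (h1S : T₁ ≠ S) (h2S : T₂ ≠ S) (hr : radius T₁ < r)
    (e₁ : excess S T₁ (angle V) r = 0) (e₂ : excess S T₂ (angle V) r = 0) :
    IsJunction 𝒮 S r V := by
  rw [← hdist_eq_iff_excess_eq_zero _ hS, ellipsePoint_angle hS hV] at e₁ e₂
  exact ⟨hV, hcl, T₁, h₁, T₂, h₂, h12, h1S, h2S, hr, e₁, e₂⟩

theorem excess_angle_nonneg {𝒮 : Finset HPlane} {S V T : HPlane} {r : ℝ} (hS : radius S < r)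
    (hV : V ∈ beachEllipse S r) (hcl : IsClosestSite 𝒮 V S) (hT : T ∈ 𝒮) :
    0 ≤ excess S T (angle V) r := by
  rw [← hdist_le_iff_excess_nonneg _ hS, ellipsePoint_angle hS hV]
  exact hcl.2 T hT

/-! ### Moving segments -/

/-- Whether a moving segment meets `W` does not change over an interval of radii on which it meets
`W` only if it meets the smaller set `W'`. -/
theorem IsMovingSegment.nonempty_inter {𝒮 : Finset HPlane} {S : HPlane} {J J' : Set ℝ}
    {C : ℝ → Set HPlane} (hC : IsMovingSegment 𝒮 S J C) (hJ : J' ⊆ J) (hJ' : J'.OrdConnected)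
    {W W' : Set HPlane} {δ : ℝ} (hδ : 0 < δ) (hW : ∀ P ∈ W', ∀ Q, dist P Q < δ → Q ∈ W)
    (h : ∀ R ∈ J', (C R ∩ W).Nonempty → (C R ∩ W').Nonempty) {R₁ R₂ : ℝ} (h₁ : R₁ ∈ J')
    (h₂ : R₂ ∈ J') (hne : (C R₁ ∩ W).Nonempty) : (C R₂ ∩ W).Nonempty := by
  obtain ⟨η, hη, hdist⟩ := exists_hdist_lt_imp_dist_lt hδ
  -- By both halves of Hausdorff continuity, meeting `W` is a locally constant property on the
  -- connected set `J'`.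
  refine hJ'.isPreconnected.induction₂' (fun x y => (C x ∩ W).Nonempty → (C y ∩ W).Nonempty)
    (fun R₀ hR₀ => ?_) (fun _ _ _ _ _ _ f g a => g (f a)) h₁ h₂ hne
  filter_upwards [nhdsWithin_mono _ hJ (hC.2 R₀ (hJ hR₀) η hη), self_mem_nhdsWithin]
    with R hR hRJ
  constructor
  · intro h0
    obtain ⟨Q, hQ, hQW⟩ := h R₀ hR₀ h0
    obtain ⟨P, hP, hPQ⟩ := hR.2 Q hQ
    exact ⟨P, hP, hW Q hQW P (dist_comm P Q ▸ hdist P Q hPQ)⟩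
  · intro h0
    obtain ⟨P, hP, hPW⟩ := h R hRJ h0
    obtain ⟨Q, hQ, hPQ⟩ := hR.1 P hP
    exact ⟨Q, hQ, hW P hPW Q (hdist P Q hPQ)⟩

/-- The continuing curve is the ellipse point in the fixed direction `θ`. It stays active near `r`,
and one radius at which it lies on the segment suffices for all radii in `J` close to `r`. -/
theorem remainsActiveBeyond_of_frequently {𝒮 : Finset HPlane} {S : HPlane} (hS : S ∈ 𝒮)
    {J : Set ℝ} {C : ℝ → Set HPlane} {r θ : ℝ} (hr : radius S < r) (hJ : J.OrdConnected)
    (hJr : ∀ R ∈ J, R ≤ r) (hC : IsMovingSegment 𝒮 S J C) (hθ : IsInteriorDirection 𝒮 S r θ)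
    (hfreq : ∃ᶠ R in 𝓝[J] r, ellipsePoint S θ R ∈ C R) : RemainsActiveBeyond 𝒮 S J C r := by
  set Q := ellipsePoint S θ r with hQ
  obtain ⟨δ, hδ, hball⟩ := Metric.eventually_nhds_iff_ball.1 (hθ.eventually_mem hS hr)
  have hcont : ContinuousAt (ellipsePoint S θ) r :=
    (continuousOn_ellipsePoint S θ).continuousAt (Ioi_mem_nhds hr)
  have hact : ∀ᶠ R in 𝓝 r, ellipsePoint S θ R ∈ activePart 𝒮 S R := by
    have ht : Tendsto (fun R : ℝ => (θ, R)) (𝓝 r) (𝓝 (θ, r)) :=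
      Continuous.tendsto (by fun_prop) r
    filter_upwards [ht.eventually hθ.eventually, lt_mem_nhds hr] with R hR hSR
    exact ellipsePoint_mem_activePart hS hSR (hR θ left_mem_uIcc)
  have hclose : ∀ᶠ R in 𝓝 r, dist (ellipsePoint S θ R) Q < δ / 2 :=
    hcont.eventually (Metric.ball_mem_nhds _ (half_pos hδ))
  obtain ⟨ε, hε, hnear⟩ := Metric.eventually_nhds_iff_ball.1
    ((hact.and hclose).and (lt_mem_nhds hr))
  set ε' := min ε δ with hε'
  have hε'0 : 0 < ε' := lt_min hε hδ
  set J' := J ∩ Ioi (r - ε') with hJ'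
  have hJball : ∀ R ∈ J', R ∈ Metric.ball r ε' := fun R hR => by
    rw [Metric.mem_ball, Real.dist_eq, abs_lt]
    have := hR.2
    rw [mem_Ioi] at this
    constructor <;> linarith [hJr R hR.1]
  have hstep : ∀ R ∈ J', (C R ∩ Metric.ball Q δ).Nonempty → ellipsePoint S θ R ∈ C R := by
    rintro R hR ⟨P, hPC, hP⟩
    refine hball (P, R) ?_ (C R) (hC.1 R hR.1) hPC
    rw [Metric.mem_ball, Prod.dist_eq]
    exact max_lt hP ((hJball R hR).trans_le (min_le_right _ _))
  have hin : ∀ R ∈ J', ellipsePoint S θ R ∈ Metric.ball Q (δ / 2) := fun R hR =>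
    (hnear R (Metric.ball_subset_ball (min_le_left _ _) (hJball R hR))).1.2
  have hJ'nhds : ∀ᶠ R in 𝓝[J] r, R ∈ J' := by
    filter_upwards [self_mem_nhdsWithin,
      nhdsWithin_le_nhds (Ioi_mem_nhds (show r - ε' < r by linarith))] with R h1 h2 using ⟨h1, h2⟩
  obtain ⟨a, haC, ha⟩ := (hfreq.and_eventually hJ'nhds).exists
  -- Meeting the `δ`-ball forces the segment to contain the point in direction `θ`, hence to meet
  -- the half ball.
  have hall : ∀ R ∈ J', ellipsePoint S θ R ∈ C R := fun R hR => by
    refine hstep R hR (hC.nonempty_inter (J' := J') inter_subset_left (hJ.inter ordConnected_Ioi)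
      (W := Metric.ball Q δ) (W' := Metric.ball Q (δ / 2)) (half_pos hδ) (fun P hP P' hPP' => ?_)
      (fun R hR hne => ⟨_, hstep R hR hne, hin R hR⟩) ha hR
      ⟨_, haC, Metric.ball_subset_ball (by linarith) (hin a ha)⟩)
    rw [Metric.mem_ball] at hP ⊢
    have := dist_triangle P' P Q
    rw [dist_comm P' P] at this
    linarith
  have haε : a ∈ Metric.ball r ε :=
    Metric.ball_subset_ball (min_le_left _ _) (hJball a ha)
  refine ⟨a, ha.1, ε / 2, half_pos hε, ellipsePoint S θ, ?_, fun R hR haR => ?_, fun R hR => ?_⟩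
  · exact (continuousOn_ellipsePoint S θ).mono fun R hR => (hnear a haε).2.trans_le hR.1
  · exact hall R ⟨hR, lt_of_lt_of_le ha.2 haR⟩
  · refine (hnear R ?_).1.1
    rw [Metric.mem_ball, Real.dist_eq, abs_lt]
    constructor <;> linarith [hR.1, hR.2]

/-- A segment that is active at `r` and becomes inactive consists of junctions. -/
theorem isJunction_of_mem {𝒮 : Finset HPlane} {S V : HPlane} {J : Set ℝ} {C : ℝ → Set HPlane}
    {r : ℝ} (hr : radius S < r) (hJ : J.OrdConnected) (hJr : ∀ R ∈ J, R ≤ r)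
    (hC : IsMovingSegment 𝒮 S J C) (hno : ¬ RemainsActiveBeyond 𝒮 S J C r) (hrJ : r ∈ J)
    (hV : V ∈ C r) : IsJunction 𝒮 S r V := by
  have hact := (hC.1 r hrJ).subset hV
  obtain ⟨hS, hVE, hall⟩ := (mem_activePart_iff hr).1 hact
  have hcl : IsClosestSite 𝒮 V S := ⟨hS, fun T hT => (hall T hT).1⟩
  have hVpt := ellipsePoint_angle hr hVE
  have hact' := hact
  rw [← hVpt, ellipsePoint_mem_activePart_iff hS hr] at hact'
  have hT : ∀ T ∈ 𝒮.erase S, T ≠ S ∧ 0 ≤ excess S T (angle V) r ∧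
      (radius T < r ∨ 0 < excess S T (angle V) r) := by
    intro T hT
    obtain ⟨hTS, hT⟩ := Finset.mem_erase.1 hT
    refine ⟨hTS, (hact' T hT).1, ?_⟩
    rcases lt_trichotomy (radius T) r with h | h | h
    · exact Or.inl h
    · exact Or.inr ((hact' T hT).2 h)
    · exact Or.inr (excess_pos_of_radius_lt hr h _)
  rcases exists_two_crossings_or_side hr hT with ⟨T₁, h₁, T₂, h₂, h12, e₁, e₂⟩ | ⟨σ, hσ, hside⟩
  · exact isJunction_of_crossings hr hVE hcl (Finset.mem_of_mem_erase h₁)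
      (Finset.mem_of_mem_erase h₂) h12 (hT T₁ h₁).1 (hT T₂ h₂).1
      ((hT T₁ h₁).2.2.resolve_right e₁.not_gt) e₁ e₂
  · exfalso
    -- No direction has to be avoided: at the active point `V`, sites on the sweep circle already
    -- have positive excess.
    obtain ⟨θ₁, -, hpos, hev⟩ := exists_direction hσ hside (fun T h => (hT T h).2.1)
      countable_empty
    have hint : IsInteriorDirection 𝒮 S r θ₁ := fun T hT hTS =>
      hpos T (Finset.mem_erase.2 ⟨hTS, hT⟩)
    have harc := hev.self_of_nhds fun T h => (hT T h).2.1
    have hmem : ellipsePoint S θ₁ r ∈ C r := by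
      refine (hC.1 r hrJ).ellipsePoint_mem hr (hVpt.symm ▸ hV) fun θ hθ => ?_
      rw [ellipsePoint_mem_activePart_iff hS hr]
      intro T hT'
      by_cases hTS : T = S
      · subst hTS
        exact ⟨(excess_self _ _ _).ge, fun h => absurd h hr.ne⟩
      have hTe := Finset.mem_erase.2 ⟨hTS, hT'⟩
      exact ⟨(harc θ hθ T hTe).1, fun h => (harc θ hθ T hTe).2 ((hact' T hT').2 h)⟩
    refine hno (remainsActiveBeyond_of_frequently hS hr hJ hJr hC hint ?_)
    intro hcon
    exact (hcon.self_of_nhdsWithin hrJ) hmem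

/-- These are the directions in which a site on the sweep circle has excess zero; a generic
direction avoids them. -/
theorem countable_cos_sub_eq_one (𝒮 : Finset HPlane) :
    {θ : ℝ | ∃ T ∈ 𝒮, Real.cos (θ - angle T) = 1}.Countable := by
  have h : {θ : ℝ | ∃ T ∈ 𝒮, Real.cos (θ - angle T) = 1} ⊆
      ⋃ T ∈ 𝒮, range fun n : ℤ => (n : ℝ) * (2 * Real.pi) + angle T := by
    rintro θ ⟨T, hT, h⟩
    obtain ⟨n, hn⟩ := (Real.cos_eq_one_iff _).1 h
    exact mem_iUnion₂.2 ⟨T, hT, n, by simp only; linarith⟩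
  exact (𝒮.countable_toSet.biUnion fun T _ => countable_range _).mono h

/-- Segments that become inactive at `r`, without being active at `r`, accumulate only at
junctions. -/
theorem eventually_notMem_of_not_isJunction {𝒮 : Finset HPlane} {S V : HPlane} {J : Set ℝ}
    {C : ℝ → Set HPlane} {r : ℝ} (hS : S ∈ 𝒮) (hr : radius S < r) (hJ : J.OrdConnected)
    (hJr : ∀ R ∈ J, R < r) (hC : IsMovingSegment 𝒮 S J C)
    (hno : ¬ RemainsActiveBeyond 𝒮 S J C r) (hV : ¬ IsJunction 𝒮 S r V) :
    ∀ᶠ p : HPlane × ℝ in 𝓝 V ×ˢ 𝓝[J] r, p.1 ∉ C p.2 := by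
  by_contra hfreq
  have hfreq : ∃ᶠ p : HPlane × ℝ in 𝓝 V ×ˢ 𝓝[J] r, p.1 ∈ C p.2 := by
    rwa [Filter.Frequently]
  have hle : 𝓝 V ×ˢ 𝓝[J] r ≤ 𝓝 (V, r) := by
    rw [nhds_prod_eq]
    exact prod_mono le_rfl nhdsWithin_le_nhds
  have hmemJ : ∀ᶠ p : HPlane × ℝ in 𝓝 V ×ˢ 𝓝[J] r,
      p.2 ∈ J ∧ radius S < p.2 ∧ ∀ T ∈ 𝒮, radius T < r → radius T < p.2 := by
    have h1 : ∀ᶠ R in 𝓝[J] r, R ∈ J ∧ radius S < R ∧ ∀ T ∈ 𝒮, radius T < r → radius T < R := by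
      refine eventually_mem_nhdsWithin.and (nhdsWithin_le_nhds ((lt_mem_nhds hr).and ?_))
      rw [Finset.eventually_all]
      intro T _
      by_cases hT : radius T < r
      · filter_upwards [lt_mem_nhds hT] with R hR _ using hR
      · exact Eventually.of_forall fun _ h => absurd h hT
    exact h1.prod_inr _
  have hactive : ∃ᶠ p : HPlane × ℝ in 𝓝 (V, r), p.1 ∈ beachEllipse S p.2 ∧
      ∀ T ∈ 𝒮, hdist p.1 S ≤ hdist p.1 T := by
    refine (hfreq.and_eventually hmemJ).filter_mono hle |>.mono ?_
    rintro p ⟨hp, hpJ, hpr, -⟩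
    obtain ⟨-, h1, h2⟩ := (mem_activePart_iff hpr).1 ((hC.1 p.2 hpJ).subset hp)
    exact ⟨h1, fun T hT => (h2 T hT).1⟩
  -- The ellipse equation and the cell inequalities are closed conditions, so they pass to the
  -- limit.
  have hVE : V ∈ beachEllipse S r := by
    have hc : Continuous fun p : HPlane × ℝ => p.2 - radius p.1 :=
      continuous_snd.sub continuous_radius.fst'
    by_contra hne
    have hne' : hdist V S ≠ r - radius V := hne
    have hc' : Continuous fun p : HPlane × ℝ => hdist p.1 S := (continuous_hdist_left S).fst'
    have hev : ∀ᶠ p : HPlane × ℝ in 𝓝 (V, r), hdist p.1 S ≠ p.2 - radius p.1 :=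
      (isOpen_ne_fun hc' hc).eventually_mem hne'
    obtain ⟨p, hp, hp'⟩ := (hactive.and_eventually hev).exists
    exact hp' hp.1
  have hcl : IsClosestSite 𝒮 V S := by
    refine ⟨hS, fun T hT => not_lt.1 fun hlt => ?_⟩
    have hev : ∀ᶠ P in 𝓝 V, hdist P T < hdist P S :=
      (continuous_hdist_left T).continuousAt.eventually_lt (continuous_hdist_left S).continuousAt hlt
    have hev' : ∀ᶠ p : HPlane × ℝ in 𝓝 (V, r), hdist p.1 T < hdist p.1 S :=
      (continuousAt_fst (p := (V, r))).eventually hev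
    obtain ⟨p, hp, hp'⟩ := (hactive.and_eventually hev').exists
    exact (hp.2 T hT).not_gt hp'
  have hV0 := ne_zero_of_mem_beachEllipse hr hVE
  -- Sites of radius at least `r` are outside the sweep circle for every `R ∈ J`, so they cannot
  -- obstruct the arc. They matter only at the limit radius `r`.
  set 𝒯 := (𝒮.erase S).filter fun T => radius T < r with h𝒯
  have hT : ∀ T ∈ 𝒯, T ∈ 𝒮 ∧ T ≠ S ∧ radius T < r := fun T hT => by
    obtain ⟨h1, h2⟩ := Finset.mem_filter.1 hT
    exact ⟨Finset.mem_of_mem_erase h1, Finset.ne_of_mem_erase h1, h2⟩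
  have hnn : ∀ T ∈ 𝒯, 0 ≤ excess S T (angle V) r := fun T h =>
    excess_angle_nonneg hr hVE hcl (hT T h).1
  rcases exists_two_crossings_or_side hr (𝒯 := 𝒯) (θ₀ := angle V)
    (fun T h => ⟨(hT T h).2.1, hnn T h, Or.inl (hT T h).2.2⟩) with
    ⟨T₁, h₁, T₂, h₂, h12, e₁, e₂⟩ | ⟨σ, hσ, hside⟩
  · exact hV (isJunction_of_crossings hr hVE hcl (hT T₁ h₁).1 (hT T₂ h₂).1 h12 (hT T₁ h₁).2.1
      (hT T₂ h₂).2.1 (hT T₁ h₁).2.2 e₁ e₂)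
  obtain ⟨θ₁, hθ₁, hpos, hev⟩ := exists_direction hσ hside hnn (countable_cos_sub_eq_one 𝒮)
  have hint : IsInteriorDirection 𝒮 S r θ₁ := by
    intro T hT hTS
    rcases lt_trichotomy (radius T) r with h | h | h
    · exact hpos T (Finset.mem_filter.2 ⟨Finset.mem_erase.2 ⟨hTS, hT⟩, h⟩)
    · rw [excess_eq_of_radius_eq S h]
      have h1 := sub_pos.2 (cosh_radius_lt_cosh hr)
      have h2 := Real.sinh_pos_iff.2 ((radius_nonneg S).trans_lt hr)
      have h3 : Real.cos (θ₁ - angle T) < 1 :=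
        lt_of_le_of_ne (Real.cos_le_one _) fun h => hθ₁ ⟨T, hT, h⟩
      have := sub_pos.2 h3
      positivity
    · exact excess_pos_of_radius_lt hr h _
  have ht : Tendsto (fun p : HPlane × ℝ => (nearAngle V p.1, p.2)) (𝓝 V ×ˢ 𝓝[J] r)
      (𝓝 (angle V, r)) := by
    rw [nhds_prod_eq]
    exact (tendsto_nearAngle hV0).prodMap (tendsto_id.mono_left nhdsWithin_le_nhds)
  refine hno (remainsActiveBeyond_of_frequently hS hr hJ (fun R hR => (hJr R hR).le) hC hint ?_)
  have hgoal : ∃ᶠ p : HPlane × ℝ in 𝓝 V ×ˢ 𝓝[J] r, ellipsePoint S θ₁ p.2 ∈ C p.2 := by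
    refine (hfreq.and_eventually (hmemJ.and (ht.eventually hev))).mono ?_
    rintro ⟨P, R⟩ ⟨hP, ⟨hRJ, hSR, hTR⟩, harc⟩
    simp only at hP hRJ hSR hTR harc
    have hA := (hC.1 R hRJ).subset hP
    have hpt := ellipsePoint_nearAngle hSR hV0 hA.2.1
    have hA' := hA
    rw [← hpt, ellipsePoint_mem_activePart_iff hS hSR] at hA'
    refine (hC.1 R hRJ).ellipsePoint_mem hSR (hpt.symm ▸ hP) fun θ hθ => ?_
    rw [ellipsePoint_mem_activePart_iff hS hSR]
    intro T hT'
    by_cases hTS : T = S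
    · subst hTS
      exact ⟨(excess_self _ _ _).ge, fun h => absurd h hSR.ne⟩
    rcases lt_or_ge (radius T) r with hTr | hTr
    · have hT𝒯 : T ∈ 𝒯 := Finset.mem_filter.2 ⟨Finset.mem_erase.2 ⟨hTS, hT'⟩, hTr⟩
      exact ⟨(harc (fun T h => (hA' T (hT T h).1).1) θ hθ T hT𝒯).1,
        fun h => absurd h (hTR T hT' hTr).ne⟩
    · have := excess_pos_of_radius_lt hSR ((hJr R hRJ).trans_le hTr) θ
      exact ⟨this.le, fun _ => this⟩
  intro hcon
  exact hgoal (hcon.prod_inr _)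

/-! ### The end of a moving segment -/

theorem eventually_hdist_lt_of_ball {C : ℝ → Set HPlane} {V : HPlane} {l : Filter ℝ}
    (h : ∀ δ > 0, ∀ᶠ R in l, C R ⊆ Metric.ball V δ) :
    ∀ δ > 0, ∀ᶠ R in l, ∀ P ∈ C R, hdist P V < δ := by
  intro δ hδ
  have h1 : ∀ᶠ P in 𝓝 V, hdist P V < δ :=
    (continuous_hdist_left V).continuousAt.eventually_lt_const ((hdist_self V).trans_lt hδ)
  obtain ⟨η, hη, hball⟩ := Metric.eventually_nhds_iff_ball.1 h1
  filter_upwards [h η hη] with R hR P hP using hball P (hR hP)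

/-- `C r` is connected and consists of isolated junctions, so it is a single point; Hausdorff
continuity at `r` does the rest. -/
theorem exists_isJunction_of_mem {𝒮 : Finset HPlane} {S : HPlane} {J : Set ℝ} {C : ℝ → Set HPlane}
    {r : ℝ} (hr : radius S < r) (hJ : J.OrdConnected) (hJr : ∀ R ∈ J, R ≤ r)
    (hC : IsMovingSegment 𝒮 S J C) (hno : ¬ RemainsActiveBeyond 𝒮 S J C r) (hrJ : r ∈ J) :
    ∃ V, IsJunction 𝒮 S r V ∧ ∀ δ > 0, ∀ᶠ R in 𝓝[J] r, ∀ P ∈ C R, hdist P V < δ := by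
  have hjun : ∀ V ∈ C r, IsJunction 𝒮 S r V := fun V hV =>
    isJunction_of_mem hr hJ hJr hC hno hrJ hV
  obtain ⟨V, hV⟩ := (hC.1 r hrJ).nonempty
  refine ⟨V, hjun V hV, fun δ hδ => ?_⟩
  have hsingle : C r ⊆ {V} := by
    intro P hP
    by_contra hPV
    have hiso := eventually_not_isJunction (𝒮 := 𝒮) hr (hjun V hV).1
    rw [eventually_nhdsWithin_iff, eventually_nhds_iff] at hiso
    obtain ⟨U, hU, hUo, hVU⟩ := hiso
    obtain ⟨Q, hQ, hQU, hQV⟩ := (hC.1 r hrJ).isPreconnected U {V}ᶜ hUo isOpen_compl_singleton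
      (fun Q _ => (em (Q = V)).imp (fun h : Q = V => h ▸ hVU) id) ⟨V, hV, hVU⟩ ⟨P, hP, hPV⟩
    exact hU Q hQU hQV (hjun Q hQ)
  filter_upwards [hC.2 r hrJ δ hδ] with R hR P hP
  obtain ⟨Q, hQ, hPQ⟩ := hR.1 P hP
  rwa [← hsingle hQ]

/-- By compactness the segments accumulate somewhere, necessarily at a junction. A shell around this
isolated junction is eventually free of them, and connectedness traps them inside. -/
theorem exists_isJunction_of_notMem {𝒮 : Finset HPlane} {S : HPlane} {J : Set ℝ}
    {C : ℝ → Set HPlane} {r : ℝ} (hS : S ∈ 𝒮) (hr : radius S < r) (hJ : J.OrdConnected)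
    (hJr : ∀ R ∈ J, R < r) (hne : (𝓝[J] r).NeBot) (hC : IsMovingSegment 𝒮 S J C)
    (hno : ¬ RemainsActiveBeyond 𝒮 S J C r) :
    ∃ V, IsJunction 𝒮 S r V ∧ ∀ δ > 0, ∀ᶠ R in 𝓝[J] r, ∀ P ∈ C R, hdist P V < δ := by
  -- The tube lemma makes pointwise avoidance uniform on a compact set.
  have havoid : ∀ K : Set HPlane, IsCompact K →
      (∀ P ∈ K, ∀ᶠ p : HPlane × ℝ in 𝓝 P ×ˢ 𝓝[J] r, p.1 ∉ C p.2) →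
      ∀ᶠ R in 𝓝[J] r, ∀ P ∈ K, P ∉ C R := by
    intro K hK h
    obtain ⟨u, hu, v, hv, huv⟩ := mem_prod_iff.1 (hK.mem_nhdsSet_prod_of_forall h)
    filter_upwards [hv] with R hR P hP
    exact huv (mk_mem_prod (subset_of_mem_nhdsSet hu hP) hR)
  obtain ⟨V, hV⟩ : ∃ V, ¬ ∀ᶠ p : HPlane × ℝ in 𝓝 V ×ˢ 𝓝[J] r, p.1 ∉ C p.2 := by
    by_contra! hall
    obtain ⟨R, hR, hRJ⟩ := ((havoid (Metric.closedBall 0 r) (isCompact_closedBall 0 r)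
      fun P _ => hall P).and eventually_mem_nhdsWithin).exists
    obtain ⟨P, hP⟩ := (hC.1 R hRJ).nonempty
    refine hR P ?_ hP
    have := radius_le_of_mem_beachEllipse ((hC.1 R hRJ).subset hP).2.1
    rw [mem_closedBall_zero_iff]
    exact this.trans (hJr R hRJ).le
  have hVj : IsJunction 𝒮 S r V := by
    by_contra h
    exact hV (eventually_notMem_of_not_isJunction hS hr hJ hJr hC hno h)
  refine ⟨V, hVj, eventually_hdist_lt_of_ball fun δ hδ => ?_⟩
  have hiso := eventually_not_isJunction (𝒮 := 𝒮) hr hVj.1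
  rw [eventually_nhdsWithin_iff] at hiso
  obtain ⟨η, hη, hball⟩ := Metric.eventually_nhds_iff_ball.1 hiso
  set d := min δ η / 4 with hd
  have hd0 : 0 < d := by have := lt_min hδ hη; positivity
  have hdδ : 2 * d < δ := by have := min_le_left δ η; linarith
  have hdη : 2 * d < η := by have := min_le_right δ η; linarith
  have hshell : ∀ᶠ R in 𝓝[J] r, ∀ P ∈ Metric.closedBall V (2 * d) \ Metric.ball V d, P ∉ C R := by
    refine havoid _ ((isCompact_closedBall V (2 * d)).diff Metric.isOpen_ball) fun P hP => ?_
    refine eventually_notMem_of_not_isJunction hS hr hJ hJr hC hno (hball P ?_ ?_)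
    · exact lt_of_le_of_lt hP.1 hdη
    · rintro rfl
      exact hP.2 (Metric.mem_ball_self hd0)
  obtain ⟨ε, hε, hεsub⟩ := Metric.mem_nhdsWithin_iff.1 hshell
  have hJ'mem : ∀ᶠ R in 𝓝[J] r, R ∈ J ∩ Metric.ball r ε :=
    eventually_mem_nhdsWithin.and (nhdsWithin_le_nhds (Metric.ball_mem_nhds r hε))
  have hstep : ∀ R ∈ J ∩ Metric.ball r ε, (C R ∩ Metric.ball V (2 * d)).Nonempty →
      (C R ∩ Metric.ball V d).Nonempty := by
    rintro R ⟨hRJ, hRε⟩ ⟨P, hP, hPb⟩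
    refine ⟨P, hP, by_contra fun h => ?_⟩
    exact hεsub ⟨hRε, hRJ⟩ P ⟨Metric.ball_subset_closedBall hPb, h⟩ hP
  obtain ⟨R₁, ⟨P₁, hP₁⟩, hR₁⟩ : ∃ R₁, (C R₁ ∩ Metric.ball V (2 * d)).Nonempty ∧
      R₁ ∈ J ∩ Metric.ball r ε := by
    by_contra! hcon
    refine hV ?_
    have hVb : ∀ᶠ P in 𝓝 V, P ∈ Metric.ball V (2 * d) := Metric.ball_mem_nhds V (by linarith)
    filter_upwards [hVb.prod_inl (𝓝[J] r), hJ'mem.prod_inr (𝓝 V)] with p hp1 hp2 hpC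
    exact hcon p.2 ⟨p.1, hpC, hp1⟩ hp2
  have hord : (J ∩ Metric.ball r ε).OrdConnected := by
    rw [Real.ball_eq_Ioo]
    exact hJ.inter ordConnected_Ioo
  filter_upwards [hJ'mem] with R hR
  have hmeet := hC.nonempty_inter inter_subset_left hord (W := Metric.ball V (2 * d))
    (W' := Metric.ball V d) hd0 (fun P hP Q hPQ => by
      rw [Metric.mem_ball] at hP ⊢
      have := dist_triangle Q P V
      rw [dist_comm Q P] at this
      linarith) hstep hR₁ hR ⟨P₁, hP₁⟩
  have hsub : C R ⊆ Metric.ball V d := by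
    refine (hC.1 R hR.1).isPreconnected.subset_left_of_subset_union Metric.isOpen_ball
      (Metric.isClosed_closedBall (x := V) (ε := 2 * d)).isOpen_compl ?_ ?_ (hstep R hR hmeet)
    · exact disjoint_left.2 fun P h1 h2 => h2 (Metric.closedBall_subset_closedBall (by linarith)
        (Metric.ball_subset_closedBall h1))
    · intro P hP
      by_contra hcon
      rw [mem_union, not_or, notMem_compl_iff] at hcon
      exact hεsub ⟨hR.2, hR.1⟩ P ⟨hcon.2, hcon.1⟩ hP
  exact hsub.trans (Metric.ball_subset_ball (by linarith))

/-! ### A site event -/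

/-- The ellipse is degenerate here, and `S` hides every other point of its radial segment. -/
theorem eq_of_mem_activePart_radius {𝒮 : Finset HPlane} {S P : HPlane}
    (h : P ∈ activePart 𝒮 S (radius S)) : P = S := by
  by_contra hne
  obtain ⟨hS, hP, hno⟩ := h
  have hPS : hdist P S = radius S - radius P := hP
  have hlt : radius P < radius S := by linarith [hdist_pos hne]
  refine hno ⟨S, hS, S, ?_, ?_, hlt⟩
  · change hdist S S = _
    rw [hdist_self, sub_self]
  · by_cases hP0 : P = 0
    · exact Or.inl hP0
    · refine Or.inr (Or.inr (angle_eq_of_hdist_eq hP0 ?_ ?_))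
      · rintro rfl
        rw [(radius_eq_zero_iff 0).2 rfl] at hlt
        linarith [radius_nonneg P]
      · rw [hPS, abs_of_neg (by linarith)]
        ring

/-- A segment of `S` does not become inactive when the sweep circle meets `S`. -/
theorem remainsActiveBeyond_radius {𝒮 : Finset HPlane} {S : HPlane} {J : Set ℝ}
    {C : ℝ → Set HPlane} (hC : IsMovingSegment 𝒮 S J C) (hJ : radius S ∈ J)
    (hle : ∀ R ∈ J, R ≤ radius S) : RemainsActiveBeyond 𝒮 S J C (radius S) := by
  obtain ⟨P, hP⟩ := (hC.1 _ hJ).nonempty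
  have hPA := (hC.1 _ hJ).subset hP
  obtain rfl : P = S := eq_of_mem_activePart_radius hPA
  have hS : P ∈ 𝒮 := hPA.1.1
  set s := radius P with hs
  -- On the ray of the site, the ellipse point is halfway between the site and the sweep circle.
  set γ : ℝ → HPlane := fun R => polar ((R + s) / 2) (angle P) with hγ
  have hγc : Continuous γ := by
    simp only [hγ, polar]
    fun_prop
  have hγs : γ s = P := by
    simp only [hγ, add_self_div_two]
    exact polar_radius_angle P
  have hs0 : 0 ≤ s := radius_nonneg P
  have hev : ∀ᶠ R in 𝓝 s, ∀ T ∈ 𝒮, T ≠ P → hdist (γ R) P < hdist (γ R) T := by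
    rw [Finset.eventually_all]
    intro T _
    by_cases hT : T = P
    · exact Eventually.of_forall fun _ h => absurd hT h
    have c : ∀ W, Continuous fun R => hdist (γ R) W := fun W =>
      (continuous_hdist_left W).comp hγc
    filter_upwards [(c P).continuousAt.eventually_lt (c T).continuousAt
      (by rw [hγs, hdist_self]; exact hdist_pos (Ne.symm hT))] with R hR _ using hR
  obtain ⟨ε, hε, hball⟩ := Metric.eventually_nhds_iff_ball.1 hev
  refine ⟨s, hJ, ε / 2, half_pos hε, γ, hγc.continuousOn, fun R hR hsR => ?_, fun R hR => ?_⟩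
  · rw [le_antisymm (hle R hR) hsR, hγs]
    exact hP
  · rcases hR.1.eq_or_lt with rfl | hlt
    · rw [hγs]
      exact hPA
    have hR0 : 0 ≤ (R + s) / 2 := by linarith
    have hclose := hball R (by
      rw [Metric.mem_ball, Real.dist_eq, abs_lt]
      constructor <;> linarith [hR.2])
    refine (mem_activePart_iff hlt).2 ⟨hS, ?_, fun T hT => ?_⟩
    · change hdist _ _ = _
      simp only [hγ]
      rw [hdist_polar_of_sameAngle hR0, radius_polar hR0, abs_of_nonneg (by linarith)]
      linarith
    · by_cases hTP : T = P
      · rw [hTP]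
        exact ⟨le_rfl, fun h => absurd h hlt.ne⟩
      · exact ⟨(hclose T hT hTP).le, fun _ => hclose T hT hTP⟩

/-! ### The cases combined, and the theorem. -/

theorem BecomesInactiveAt.exists_isJunction {𝒮 : Finset HPlane} {S : HPlane} {J : Set ℝ}
    {C : ℝ → Set HPlane} {r : ℝ} (h : BecomesInactiveAt 𝒮 S J C r) :
    ∃ V, IsJunction 𝒮 S r V ∧ ∀ δ > 0, ∀ᶠ R in 𝓝[J] r, ∀ P ∈ C R, hdist P V < δ := by
  obtain ⟨⟨R₀, hR₀⟩, hJ, hlub, hC, hno⟩ := h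
  have hseen : ∀ R ∈ J, S ∈ seenSites 𝒮 R := fun R hR => by
    obtain ⟨P, hP⟩ := (hC.1 R hR).nonempty
    exact ((hC.1 R hR).subset hP).1
  have hS : S ∈ 𝒮 := (hseen R₀ hR₀).1
  have hle : ∀ R ∈ J, R ≤ r := fun R hR => hlub.1 hR
  rcases ((hseen R₀ hR₀).2.trans (hle R₀ hR₀)).eq_or_lt with heq | hr
  · subst heq
    -- `S` is not seen before radius `radius S`, so `J` contains no smaller radius.
    have : R₀ = radius S := le_antisymm (hle R₀ hR₀) (hseen R₀ hR₀).2
    exact absurd (remainsActiveBeyond_radius hC (this ▸ hR₀) hle) hno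
  · by_cases hrJ : r ∈ J
    · exact exists_isJunction_of_mem hr hJ hle hC hno hrJ
    · exact exists_isJunction_of_notMem hS hr hJ
        (fun R hR => lt_of_le_of_ne (hle R hR) fun h => hrJ (h ▸ hR))
        (hlub.nhdsWithin_neBot ⟨R₀, hR₀⟩) hC hno

end HyperbolicSweep

theorem mainTheorem4 (𝒮 : Finset HPlane) :
    -- an active segment becomes inactive only through a (true) circle event: it shrinks to a
    -- Voronoi vertex `V` incident to its site when the sweep circle reaches the far point of `V`
    (∀ (S : HPlane) (J : Set ℝ) (C : ℝ → Set HPlane) (r : ℝ), BecomesInactiveAt 𝒮 S J C r →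
      ∃ V V' : HPlane, IsVoronoiVertex 𝒮 V ∧ IsClosestSite 𝒮 V S ∧
        IsFarPoint 𝒮 V V' ∧ radius V' = r ∧
        ∀ δ > 0, ∀ᶠ R in 𝓝[J] r, ∀ P ∈ C R, hdist P V < δ) ∧
    -- no intersection leaves the beach curve strictly between two consecutive events
    (∀ a b : EReal, ConsecutiveEvents 𝒮 a b → ∀ r : ℝ, a < (r : EReal) → (r : EReal) < b →
      ∀ S ∈ seenSites 𝒮 r, ∀ T ∈ seenSites 𝒮 r, S ≠ T →
        ∀ I : ℝ → HPlane, ¬ LeavesBeachCurveAt 𝒮 S T I r) := by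
  refine ⟨fun S J C r h => ?_, fun a b hab r har hrb S hS T hT hST I => ?_⟩
  · obtain ⟨V, hV, hshrink⟩ := h.exists_isJunction
    obtain ⟨V', hV', hrad⟩ := exists_isFarPoint hV.1 hV.2.1
    exact ⟨V, V', hV.isVoronoiVertex, hV.2.1, hV', hrad, hshrink⟩
  · obtain ⟨h1, h2⟩ := not_mem_events_between hab har hrb
    exact not_leavesBeachCurveAt h1 h2 hS hT hST I
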